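/- Let $a_1\ge a_2>0$ and $a(\theta)=a_1\cos^2\theta+a_2\sin^2\theta$ (the restriction of the quadratic form $a_1x_1^2+a_2x_2^2$ to the unit circle $\mathbb S^1$, $x_1=\cos\theta$, $x_2=\sin\theta$). Consider the eigenvalue problem on $\mathbb S^1$ $$-\big(a(\theta)u'(\theta)\big)'=\lambda\,a(\theta)u(\theta),\qquad u \ \ 2\pi\text{-periodic},$$ where $\lambda\in\mathbb R$ is an eigenvalue if there is a solution $u\not\equiv0$, and the eigenspace of $\lambda$ is the space of all solutions. The set of nonzero eigenvalues has a least element $\lambda_1=\lambda_1(a_1,a_2)$, the first nonzero eigenvalue, and the following hold. 1. $\lambda_1$ depends only on $a_1/a_2$ and is a strictly decreasing function of $a_1/a_2\in[1,\infty)$. 2. There are constants $C_1,C_2>0$, independent of $a_1$ and $a_2$, such that for all $a_1\ge a_2>0$ $$\frac{C_1a_2^{1/2}}{(a_1+a_2)^{1/2}}\le\lambda_1\le\frac{C_2a_2^{1/2}}{(a_1+a_2)^{1/2}}.$$ 3. For all $a_1\ge a_2>0$, $\displaystyle \lambda_1\le\frac{a_1+3a_2}{3a_1+a_2}$. 4.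 If $a_1>a_2$, then the eigenspace of $\lambda_1$ is one-dimensional. Every eigenfunction $u\not\equiv 0$ for $\lambda_1$ has exactly two zeros in $[0,2\pi)$, namely $\theta=\pi/2$ and $\theta=3\pi/2$, and it is odd about both points: $u(\pi/2+t)=-u(\pi/2-t)$ and $u(3\pi/2+t)=-u(3\pi/2-t)$ for all $t\in\mathbb R$. -/

import Mathlib

/-!
The weighted eigenvalue problem `-(a u')' = lam a u` on the unit circle. A function on the circle
is a `2π`-periodic function of the angle `θ`, and in this coordinate (arc length) the gradient and
the divergence of the circle are both `d/dθ`. The weights used below are smooth and positive, so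
solutions are classical.
-/

namespace CircleSL

/-- The restriction to the unit circle `(x₁, x₂) = (cos θ, sin θ)` of the quadratic form
`a₁ x₁ ^ 2 + a₂ x₂ ^ 2`. -/
noncomputable def weight (a₁ a₂ : ℝ) (θ : ℝ) : ℝ :=
  a₁ * Real.cos θ ^ 2 + a₂ * Real.sin θ ^ 2

/-- The space of solutions `u` on the circle of `(a u')' = -lam a u`: the function `u` is
`2π`-periodic and differentiable, and its flux `a u'` is differentiable with derivative
`-lam a u` at every point. -/
def eigenspace (a : ℝ → ℝ) (lam : ℝ) : Submodule ℝ (ℝ → ℝ) where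
  carrier := {u | Function.Periodic u (2 * Real.pi) ∧ Differentiable ℝ u ∧
    ∀ θ, HasDerivAt (fun t => a t * deriv u t) (-(lam * (a θ * u θ))) θ}
  zero_mem' := by
    refine ⟨fun _ => rfl, differentiable_const 0, fun θ => ?_⟩
    have h : deriv (0 : ℝ → ℝ) = fun _ => 0 := deriv_const' 0
    simpa [h] using hasDerivAt_const θ (0 : ℝ)
  add_mem' := by
    rintro u v ⟨pu, du, hu⟩ ⟨pv, dv, hv⟩
    refine ⟨pu.add pv, du.add dv, fun θ => ?_⟩
    have h : (fun t => a t * deriv (u + v) t) =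
        (fun t => a t * deriv u t) + fun t => a t * deriv v t := by
      funext t
      simp only [Pi.add_apply]
      rw [deriv_add (du t) (dv t), mul_add]
    have h2 : -(lam * (a θ * (u + v) θ)) =
        -(lam * (a θ * u θ)) + -(lam * (a θ * v θ)) := by
      simp only [Pi.add_apply]
      ring
    rw [h, h2]
    exact (hu θ).add (hv θ)
  smul_mem' := by
    rintro c u ⟨pu, du, hu⟩
    refine ⟨pu.smul c, du.const_smul c, fun θ => ?_⟩
    have h : (fun t => a t * deriv (c • u) t) = fun t => c * (a t * deriv u t) := by
      funext t
      rw [deriv_const_smul c (du t), smul_eq_mul]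
      ring
    have h2 : -(lam * (a θ * (c • u) θ)) = c * -(lam * (a θ * u θ)) := by
      simp only [Pi.smul_apply, smul_eq_mul]
      ring
    rw [h, h2]
    exact (hu θ).const_mul c

/-- `lam` is an eigenvalue if the problem has a solution that is not identically zero. -/
def IsEigenvalue (a : ℝ → ℝ) (lam : ℝ) : Prop :=
  ∃ u ∈ eigenspace a lam, u ≠ 0

/-- The set of nonzero eigenvalues. -/
def nonzeroEigenvalues (a : ℝ → ℝ) : Set ℝ :=
  {lam | lam ≠ 0 ∧ IsEigenvalue a lam}

/-- The first nonzero eigenvalue. -/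
noncomputable def lambda₁ (a : ℝ → ℝ) : ℝ :=
  sInf (nonzeroEigenvalues a)

end CircleSL

/-! The weight is invariant under θ ↦ -θ and θ ↦ π - θ, so a solution on the circle splits into four
parts, each even or odd about 0 and about π/2. Each part is a solution on the quarter circle [0,
π/2] with a Neumann condition (p = 0) or a Dirichlet condition (u = 0) at each end. The first
nonzero eigenvalue is the lowest Neumann–Dirichlet one: its positive solution `c` (`GroundState`)
extends by reflection to an eigenfunction that is even about 0 and odd about π/2.

Existence of `c` is a shooting argument in lam (`exists_groundState`). Picone's identity against `c`
(`picone`) excludes nonzero Dirichlet–Dirichlet and Neumann–Neumann solutions for 0 < lam ≤ mu, and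
Neumann–Dirichlet ones below mu. The Dirichlet–Neumann part is different in kind: reflection about
π/4 turns it into a ground state for the weight with swapped coefficients, and `compare`, a
Wronskian argument for two weights, shows that its eigenvalue is larger than mu when a₁ > a₂. The
same comparison gives strict monotonicity in the ratio. Simplicity, zeros and oddness are then read
off from `c`.

The upper bounds come from the test functions cos θ and cos θ / √a in the Rayleigh quotient
(`mul_le_of_rayleigh`). The lower bound comes from integrating the system twice, with ∫ 1/a = π /
(2√(a₁a₂)) over the quarter circle. -/

namespace CircleSL

open Real Set Filter Topology
open scoped Interval

/-- The equation `(a u')' = -lam a u` as a first-order system for `u` and its flux `p = a u'`. -/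
def Solves (a : ℝ → ℝ) (lam : ℝ) (u p : ℝ → ℝ) : Prop :=
  ∀ θ, HasDerivAt u (p θ / a θ) θ ∧ HasDerivAt p (-(lam * (a θ * u θ))) θ

/-! ### The first-order system: symmetries and uniqueness -/

namespace Solves

variable {a : ℝ → ℝ} {lam : ℝ} {u p v q : ℝ → ℝ}

theorem const_mul (h : Solves a lam u p) (k : ℝ) :
    Solves a lam (fun θ => k * u θ) (fun θ => k * p θ) := fun θ =>
  ⟨((h θ).1.const_mul k).congr_deriv (by ring), ((h θ).2.const_mul k).congr_deriv (by ring)⟩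

theorem add (h : Solves a lam u p) (h' : Solves a lam v q) :
    Solves a lam (fun θ => u θ + v θ) (fun θ => p θ + q θ) := fun θ =>
  ⟨((h θ).1.add (h' θ).1).congr_deriv (by ring), ((h θ).2.add (h' θ).2).congr_deriv (by ring)⟩

/-- Reflection about the point `x / 2`, for two weights that are reflections of each other. -/
theorem reflect {b : ℝ → ℝ} (h : Solves a lam u p) (x : ℝ) (hb : ∀ θ, a (x - θ) = b θ) :
    Solves b lam (fun θ => u (x - θ)) (fun θ => -p (x - θ)) := by
  intro θ
  have hx : HasDerivAt (fun t : ℝ => x - t) (-1) θ := by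
    simpa using (hasDerivAt_id θ).const_sub x
  constructor
  · refine ((h (x - θ)).1.comp θ hx).congr_deriv ?_
    rw [hb]
    ring
  · refine ((h (x - θ)).2.comp θ hx).neg.congr_deriv ?_
    rw [hb]
    ring

theorem continuous (h : Solves a lam u p) : Continuous u :=
  continuous_iff_continuousAt.2 fun θ => (h θ).1.continuousAt

theorem continuous_flux (h : Solves a lam u p) : Continuous p :=
  continuous_iff_continuousAt.2 fun θ => (h θ).2.continuousAt

/-- Two solutions with the same initial data at a point agree. -/
theorem unique {B : ℝ} (ha : ∀ θ, 0 < a θ) (haB : ∀ θ, a θ ≤ B) (haB' : ∀ θ, (a θ)⁻¹ ≤ B)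
    (h : Solves a lam u p) (h' : Solves a lam v q) {x : ℝ} (h0 : u x = v x) (h1 : p x = q x) :
    u = v ∧ p = q := by
  have hB : 0 ≤ B := (ha 0).le.trans (haB 0)
  set K : NNReal := ⟨B + |lam| * B, by positivity⟩ with hK
  have key : (fun t => (u t, p t)) = fun t => (v t, q t) := by
    refine ODE_solution_unique_univ (v := fun t z => (z.2 / a t, -(lam * (a t * z.1))))
      (s := fun _ => univ) (K := K) (t₀ := x) ?_ ?_ ?_ ?_
    · intro t
      refine LipschitzWith.lipschitzOnWith (LipschitzWith.of_dist_le_mul fun z w => ?_)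
      have h1 : dist z.1 w.1 ≤ dist z w := le_max_left _ _
      have h2 : dist z.2 w.2 ≤ dist z w := le_max_right _ _
      have hd : 0 ≤ dist z w := dist_nonneg
      have hl := abs_nonneg lam
      rw [hK, Prod.dist_eq (x := (_, _))]
      refine max_le ?_ ?_
      · have e : dist (z.2 / a t) (w.2 / a t) = (a t)⁻¹ * dist z.2 w.2 := by
          rw [Real.dist_eq, Real.dist_eq, ← sub_div, abs_div, abs_of_pos (ha t)]
          ring
        change dist (z.2 / a t) (w.2 / a t) ≤ (B + |lam| * B) * dist z w
        rw [e]
        have : (a t)⁻¹ * dist z.2 w.2 ≤ B * dist z w :=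
          mul_le_mul (haB' t) h2 dist_nonneg hB
        nlinarith [mul_nonneg (mul_nonneg hl hB) hd]
      · have e : dist (-(lam * (a t * z.1))) (-(lam * (a t * w.1)))
            = |lam| * (a t * dist z.1 w.1) := by
          rw [Real.dist_eq, Real.dist_eq, ← abs_of_pos (ha t), ← abs_mul, ← abs_mul, ← abs_neg,
            abs_of_pos (ha t)]
          congr 1
          ring
        change dist (-(lam * (a t * z.1))) (-(lam * (a t * w.1))) ≤ (B + |lam| * B) * dist z w
        rw [e]
        have : a t * dist z.1 w.1 ≤ B * dist z w := mul_le_mul (haB t) h1 dist_nonneg hB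
        have := mul_le_mul_of_nonneg_left this hl
        nlinarith [mul_nonneg hB hd]
    · exact fun t => ⟨(h t).1.prodMk (h t).2, mem_univ _⟩
    · exact fun t => ⟨(h' t).1.prodMk (h' t).2, mem_univ _⟩
    · simp [h0, h1]
  exact ⟨funext fun t => congrArg Prod.fst (congrFun key t),
    funext fun t => congrArg Prod.snd (congrFun key t)⟩

/-- A solution with zero initial data at a point vanishes. -/
theorem eq_zero {B : ℝ} (ha : ∀ θ, 0 < a θ) (haB : ∀ θ, a θ ≤ B) (haB' : ∀ θ, (a θ)⁻¹ ≤ B)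
    (h : Solves a lam u p) {x : ℝ} (h0 : u x = 0) (h1 : p x = 0) : u = 0 ∧ p = 0 := by
  refine h.unique ha haB haB' (v := 0) (q := 0) (fun θ => ?_) h0 h1
  constructor
  · simp
  · simp

end Solves

/-! ### The initial value problem as a power series in lam -/

/-- Iterated integrals from `0` with weights `w 0, w 1, …`. -/
noncomputable def iter (w : ℕ → ℝ → ℝ) : ℕ → ℝ → ℝ
  | 0 => fun _ => 1
  | n + 1 => fun θ => ∫ t in (0 : ℝ)..θ, w n t * iter w n t

section Iter

variable {w : ℕ → ℝ → ℝ} {B : ℝ}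

theorem iter_continuous (hw : ∀ n, Continuous (w n)) (n : ℕ) : Continuous (iter w n) := by
  induction n with
  | zero => exact continuous_const
  | succ n ih =>
    exact intervalIntegral.continuous_primitive
      (fun a b => ((hw n).mul ih).intervalIntegrable a b) 0

theorem iter_hasDerivAt (hw : ∀ n, Continuous (w n)) (n : ℕ) (θ : ℝ) :
    HasDerivAt (iter w (n + 1)) (w n θ * iter w n θ) θ :=
  ((hw n).mul (iter_continuous hw n)).integral_hasStrictDerivAt 0 θ |>.hasDerivAt

/-- The factorial makes the series in `exists_solves` converge uniformly on bounded sets, by the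
Weierstrass test. -/
theorem abs_iter_le (hw : ∀ n, Continuous (w n)) (hB : ∀ n t, |w n t| ≤ B) (n : ℕ) (θ : ℝ) :
    |iter w n θ| ≤ (B * |θ|) ^ n / n.factorial := by
  have hB0 : 0 ≤ B := (abs_nonneg _).trans (hB 0 0)
  induction n generalizing θ with
  | zero => simp [iter]
  | succ n ih =>
    have hc : Continuous fun t => B * (B ^ n / n.factorial) * |t - 0| ^ n := by fun_prop
    calc |iter w (n + 1) θ| ≤ ∫ t in Ι 0 θ, ‖w n t * iter w n t‖ :=
          show ‖∫ t in (0 : ℝ)..θ, w n t * iter w n t‖ ≤ _ from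
            intervalIntegral.norm_integral_le_integral_norm_uIoc
      _ ≤ ∫ t in Ι 0 θ, B * (B ^ n / n.factorial) * |t - 0| ^ n := by
          refine MeasureTheory.setIntegral_mono_on ?_ ?_ measurableSet_uIoc fun t _ => ?_
          · exact (((hw n).mul (iter_continuous hw n)).norm.intervalIntegrable 0 θ).def'
          · exact (hc.intervalIntegrable 0 θ).def'
          · rw [norm_mul]
            refine (mul_le_mul (hB n t) (ih t) (abs_nonneg _) hB0).trans_eq ?_
            rw [sub_zero, mul_pow]
            ring
      _ = (B * |θ|) ^ (n + 1) / (n + 1).factorial := by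
          rw [MeasureTheory.integral_const_mul, integral_pow_abs_sub_uIoc, sub_zero,
            Nat.factorial_succ]
          push_cast
          field_simp
          ring

end Iter

/-- The initial value problem `u 0 = 1`, `p 0 = 0` is globally solvable for all `lam ∈ [-1, 1]`,
and the solution is jointly continuous in `lam` and the point. -/
theorem exists_solves {a : ℝ → ℝ} {B : ℝ} (hac : Continuous a) (ha : ∀ θ, 0 < a θ)
    (haB : ∀ θ, a θ ≤ B) (haB' : ∀ θ, (a θ)⁻¹ ≤ B) :
    ∃ c P : ℝ → ℝ → ℝ, (∀ lam ∈ Icc (-1 : ℝ) 1, Solves a lam (c lam) (P lam) ∧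
      c lam 0 = 1 ∧ P lam 0 = 0) ∧
      ∀ R : ℝ, ContinuousOn (fun z : ℝ × ℝ => c z.1 z.2) (Icc (-1) 1 ×ˢ Icc (-R) R) := by
  have hB0 : 0 ≤ B := (ha 0).le.trans (haB 0)
  -- The weights alternate between a and 1/a, so that even iterates feed the flux and odd iterates
  -- feed the solution.
  set w : ℕ → ℝ → ℝ := fun n t => if Even n then a t else (a t)⁻¹ with hw_def
  have hw : ∀ n, Continuous (w n) := by
    intro n
    by_cases h : Even n
    · simpa only [hw_def, h, if_true] using hac
    · simp only [hw_def, h, if_false]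
      exact hac.inv₀ fun t => (ha t).ne'
  have hwB : ∀ n t, |w n t| ≤ B := by
    intro n t
    by_cases h : Even n
    · simpa only [hw_def, h, if_true, abs_of_pos (ha t)] using haB t
    · simpa only [hw_def, h, if_false, abs_of_pos (inv_pos.2 (ha t))] using haB' t
  set h := iter w with hh
  have h_even : ∀ n θ, HasDerivAt (h (2 * n + 1)) (a θ * h (2 * n) θ) θ := fun n θ => by
    simpa [hw_def] using iter_hasDerivAt hw (2 * n) θ
  have h_odd : ∀ n θ, HasDerivAt (h (2 * n + 2)) ((a θ)⁻¹ * h (2 * n + 1) θ) θ := fun n θ => by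
    simpa [hw_def] using iter_hasDerivAt hw (2 * n + 1) θ
  have bound : ∀ R : ℝ, ∀ θ, |θ| ≤ R → ∀ n, |h n θ| ≤ (B * R) ^ n / n.factorial := by
    intro R θ hθ n
    refine (abs_iter_le hw hwB n θ).trans ?_
    gcongr
  have sum0 : ∀ R : ℝ, Summable fun n : ℕ => (B * R) ^ n / (n.factorial : ℝ) := fun R =>
    Real.summable_pow_div_factorial _
  have sumE : ∀ R : ℝ, Summable fun n : ℕ => (B * R) ^ (2 * n) / ((2 * n).factorial : ℝ) :=
    fun R => (sum0 R).comp_injective (i := fun n => 2 * n) fun _ _ h => by simpa using h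
  have sumO : ∀ R : ℝ, Summable fun n : ℕ => (B * R) ^ (2 * n + 1) / ((2 * n + 1).factorial : ℝ) :=
    fun R => (sum0 R).comp_injective (i := fun n => 2 * n + 1) fun _ _ h => by simpa using h
  have powle : ∀ lam ∈ Icc (-1 : ℝ) 1, ∀ n : ℕ, |(-lam) ^ n| ≤ 1 := by
    intro lam hl n
    rw [abs_pow, abs_neg]
    exact pow_le_one₀ (abs_nonneg _) (abs_le.2 hl)
  have mulle : ∀ x y z : ℝ, |x| ≤ 1 → |y| ≤ z → |x * y| ≤ z := by
    intro x y z hx hy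
    rw [abs_mul]
    nlinarith [abs_nonneg x, abs_nonneg y]
  have hzero : ∀ n, h (n + 1) 0 = 0 := fun n => by simp [hh, iter]
  have hone : ∀ θ, h 0 θ = 1 := fun θ => by simp [hh, iter]
  -- Picard iteration of the system from the data (1, 0), sorted by powers of -lam. Since |lam| ≤ 1
  -- these powers drop out of all bounds.
  refine ⟨fun lam θ => ∑' n : ℕ, (-lam) ^ n * h (2 * n) θ,
    fun lam θ => ∑' n : ℕ, (-lam) ^ (n + 1) * h (2 * n + 1) θ, ?_, ?_⟩
  · intro lam hl
    refine ⟨fun θ => ?_, ?_, ?_⟩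
    · set R := |θ| + 1 with hR
      have hθR : θ ∈ Ioo (-R) R := abs_lt.1 (by rw [hR]; linarith)
      have hle : ∀ y ∈ Ioo (-R) R, |y| ≤ R := fun y hy => (abs_lt.2 hy).le
      have sE : Summable fun n : ℕ => (-lam) ^ n * h (2 * n) θ :=
        Summable.of_norm_bounded (sumE R) fun n =>
          mulle _ _ _ (powle lam hl n) (bound R θ (hle θ hθR) _)
      have sO : Summable fun n : ℕ => (-lam) ^ (n + 1) * h (2 * n + 1) θ :=
        Summable.of_norm_bounded (sumO R) fun n =>
          mulle _ _ _ (powle lam hl (n + 1)) (bound R θ (hle θ hθR) _)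
      constructor
      · have hd := hasDerivAt_tsum_of_isPreconnected (𝕜 := ℝ)
          (g := fun n y => (-lam) ^ (n + 1) * h (2 * n + 2) y)
          (g' := fun n y => (-lam) ^ (n + 1) * ((a y)⁻¹ * h (2 * n + 1) y))
          ((sumO R).mul_left B) isOpen_Ioo (convex_Ioo (-R) R).isPreconnected
          (fun n y _ => (h_odd n y).const_mul _)
          (fun n y hy => mulle _ _ _ (powle lam hl (n + 1)) (by
            rw [abs_mul, abs_of_pos (inv_pos.2 (ha y))]
            exact mul_le_mul (haB' y) (bound R y (hle y hy) _) (abs_nonneg _) hB0))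
          hθR ((summable_nat_add_iff (f := fun n : ℕ => (-lam) ^ n * h (2 * n) θ) 1).2 sE) hθR
        have hfun : (fun y => ∑' n : ℕ, (-lam) ^ n * h (2 * n) y) =ᶠ[𝓝 θ]
            fun y => 1 + ∑' n : ℕ, (-lam) ^ (n + 1) * h (2 * n + 2) y := by
          filter_upwards [isOpen_Ioo.mem_nhds hθR] with y hy
          have sy : Summable fun n : ℕ => (-lam) ^ n * h (2 * n) y :=
            Summable.of_norm_bounded (sumE R) fun n =>
              mulle _ _ _ (powle lam hl n) (bound R y (hle y hy) _)
          rw [sy.tsum_eq_zero_add]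
          simp [hone, mul_add]
        refine ((hd.const_add 1).congr_of_eventuallyEq hfun).congr_deriv ?_
        rw [div_eq_mul_inv, ← tsum_mul_right]
        exact tsum_congr fun n => by ring
      · have hd := hasDerivAt_tsum_of_isPreconnected (𝕜 := ℝ)
          (g := fun n y => (-lam) ^ (n + 1) * h (2 * n + 1) y)
          (g' := fun n y => (-lam) ^ (n + 1) * (a y * h (2 * n) y))
          ((sumE R).mul_left B) isOpen_Ioo (convex_Ioo (-R) R).isPreconnected
          (fun n y _ => (h_even n y).const_mul _)
          (fun n y hy => mulle _ _ _ (powle lam hl (n + 1)) (by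
            rw [abs_mul, abs_of_pos (ha y)]
            exact mul_le_mul (haB y) (bound R y (hle y hy) _) (abs_nonneg _) hB0))
          hθR sO hθR
        refine hd.congr_deriv ?_
        rw [← mul_assoc, ← neg_mul, ← tsum_mul_left]
        exact tsum_congr fun n => by ring
    · change ∑' n : ℕ, (-lam) ^ n * h (2 * n) 0 = 1
      rw [tsum_eq_single 0]
      · simp [hone]
      · intro n hn
        obtain ⟨m, rfl⟩ := Nat.exists_eq_succ_of_ne_zero hn
        rw [show 2 * m.succ = (2 * m + 1) + 1 by omega, hzero, mul_zero]
    · simp [hzero]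
  · intro R
    refine continuousOn_tsum (fun n => ?_) (sumE R) ?_
    · have := iter_continuous hw (2 * n)
      have h2 : Continuous fun z : ℝ × ℝ => (-z.1) ^ n * h (2 * n) z.2 := by fun_prop
      exact h2.continuousOn
    · rintro n ⟨lam, θ⟩ ⟨hl, hθ⟩
      exact mulle _ _ _ (powle lam hl n) (bound R θ (abs_le.2 hθ) _)

/-! ### The quadratic weight and its symmetries -/

section Weight

variable {a₁ a₂ : ℝ}

theorem weight_pos (h₁ : 0 < a₁) (h₂ : 0 < a₂) (θ : ℝ) : 0 < weight a₁ a₂ θ := by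
  unfold weight
  have := sin_sq_add_cos_sq θ
  rcases (sq_nonneg (cos θ)).eq_or_lt with h | h
  · rw [← h] at this ⊢
    nlinarith
  · positivity

theorem hasDerivAt_weight (a₁ a₂ θ : ℝ) :
    HasDerivAt (weight a₁ a₂) (2 * (a₂ - a₁) * (sin θ * cos θ)) θ := by
  refine ((((hasDerivAt_cos θ).pow 2).const_mul a₁).add
    (((hasDerivAt_sin θ).pow 2).const_mul a₂)).congr_deriv ?_
  simp
  ring

theorem continuous_weight (a₁ a₂ : ℝ) : Continuous (weight a₁ a₂) := by
  unfold weight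
  fun_prop

theorem weight_neg (a₁ a₂ θ : ℝ) : weight a₁ a₂ (0 - θ) = weight a₁ a₂ θ := by
  simp [weight]

theorem weight_pi_sub (a₁ a₂ θ : ℝ) : weight a₁ a₂ (π - θ) = weight a₁ a₂ θ := by
  simp [weight]

theorem weight_pi_div_two_sub (a₁ a₂ θ : ℝ) : weight a₁ a₂ (π / 2 - θ) = weight a₂ a₁ θ := by
  simp [weight, sin_pi_div_two_sub, cos_pi_div_two_sub, add_comm]

theorem weight_le (h₁ : 0 < a₁) (h₂ : 0 < a₂) (θ : ℝ) :
    weight a₁ a₂ θ ≤ a₁ + a₂ + a₁⁻¹ + a₂⁻¹ := by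
  have : 0 < a₁⁻¹ := inv_pos.2 h₁
  have : 0 < a₂⁻¹ := inv_pos.2 h₂
  unfold weight
  nlinarith [cos_sq_le_one θ, sin_sq_le_one θ]

theorem inv_weight_le (h₁ : 0 < a₁) (h₂ : 0 < a₂) (θ : ℝ) :
    (weight a₁ a₂ θ)⁻¹ ≤ a₁ + a₂ + a₁⁻¹ + a₂⁻¹ := by
  have hi₁ : 0 < a₁⁻¹ := inv_pos.2 h₁
  have hi₂ : 0 < a₂⁻¹ := inv_pos.2 h₂
  have hs := sin_sq_add_cos_sq θ
  rcases le_total a₁ a₂ with h | h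
  · have : a₁ ≤ weight a₁ a₂ θ := by
      unfold weight
      nlinarith [mul_nonneg (sub_nonneg.2 h) (sq_nonneg (sin θ))]
    linarith [inv_anti₀ h₁ this]
  · have : a₂ ≤ weight a₁ a₂ θ := by
      unfold weight
      nlinarith [mul_nonneg (sub_nonneg.2 h) (sq_nonneg (cos θ))]
    linarith [inv_anti₀ h₂ this]

variable {lam : ℝ} {u p v q : ℝ → ℝ}

theorem Solves.weight_unique (h₁ : 0 < a₁) (h₂ : 0 < a₂) (h : Solves (weight a₁ a₂) lam u p)
    (h' : Solves (weight a₁ a₂) lam v q) {x : ℝ} (hu : u x = v x) (hp : p x = q x) :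
    u = v ∧ p = q :=
  h.unique (weight_pos h₁ h₂) (weight_le h₁ h₂) (inv_weight_le h₁ h₂) h' hu hp

theorem Solves.weight_eq_zero (h₁ : 0 < a₁) (h₂ : 0 < a₂) (h : Solves (weight a₁ a₂) lam u p)
    {x : ℝ} (hu : u x = 0) (hp : p x = 0) : u = 0 ∧ p = 0 :=
  h.eq_zero (weight_pos h₁ h₂) (weight_le h₁ h₂) (inv_weight_le h₁ h₂) hu hp

end Weight

theorem mem_eigenspace_iff {a : ℝ → ℝ} (ha : ∀ θ, 0 < a θ) {lam : ℝ} {u : ℝ → ℝ} :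
    u ∈ eigenspace a lam ↔ Function.Periodic u (2 * π) ∧ ∃ p, Solves a lam u p := by
  constructor
  · rintro ⟨hper, hd, h⟩
    refine ⟨hper, fun t => a t * deriv u t, fun θ => ⟨?_, h θ⟩⟩
    rw [mul_div_cancel_left₀ _ (ha θ).ne']
    exact (hd θ).hasDerivAt
  · rintro ⟨hper, p, h⟩
    refine ⟨hper, fun θ => (h θ).1.differentiableAt, fun θ => ?_⟩
    have : (fun t => a t * deriv u t) = p := by
      funext t
      rw [(h t).1.deriv, mul_div_cancel₀ _ (ha t).ne']
    rw [this]
    exact (h θ).2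

/-! ### The ground state on the quarter circle and its extension -/

/-- `c` with flux `P` is the positive solution on `[0, π / 2)` with a vanishing derivative at `0`
and a zero at `π / 2`. -/
structure GroundState (a : ℝ → ℝ) (mu : ℝ) (c P : ℝ → ℝ) : Prop where
  solves : Solves a mu c P
  mu_pos : 0 < mu
  flux_zero : P 0 = 0
  pos : ∀ θ ∈ Ico 0 (π / 2), 0 < c θ
  zero : c (π / 2) = 0

namespace GroundState

variable {a : ℝ → ℝ} {a₁ a₂ mu : ℝ} {c P : ℝ → ℝ}

/-- The flux starts at 0 and has derivative -mu a c < 0. At π/2 this says that the zero of `c` is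
simple. -/
theorem flux_neg (g : GroundState a mu c P) (ha : ∀ θ, 0 < a θ) :
    ∀ θ ∈ Ioc 0 (π / 2), P θ < 0 := by
  have hanti : StrictAntiOn P (Icc 0 (π / 2)) := by
    refine strictAntiOn_of_deriv_neg (convex_Icc _ _) g.solves.continuous_flux.continuousOn ?_
    rw [interior_Icc]
    intro x hx
    rw [(g.solves x).2.deriv]
    have := g.pos x ⟨hx.1.le, hx.2⟩
    have := ha x
    have := g.mu_pos
    have : 0 < mu * (a x * c x) := by positivity
    linarith
  intro θ hθ
  rw [← g.flux_zero]
  exact hanti ⟨le_rfl, by positivity⟩ ⟨hθ.1.le, hθ.2⟩ hθ.1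

theorem even (h₁ : 0 < a₁) (h₂ : 0 < a₂) (g : GroundState (weight a₁ a₂) mu c P) (θ : ℝ) :
    c (-θ) = c θ := by
  have := (g.solves.reflect 0 (weight_neg a₁ a₂)).weight_unique h₁ h₂ g.solves (x := 0)
    (by simp) (by simp [g.flux_zero])
  simpa using congrFun this.1 θ

/-- The reflection of `c` about π/2 and -`c` have the same value 0 and the same flux at π/2, so
uniqueness identifies them. -/
theorem odd (h₁ : 0 < a₁) (h₂ : 0 < a₂) (g : GroundState (weight a₁ a₂) mu c P) (θ : ℝ) :
    c (π - θ) = -c θ := by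
  have := (g.solves.reflect π (weight_pi_sub a₁ a₂)).weight_unique h₁ h₂ (g.solves.const_mul (-1))
    (x := π / 2) (by simp [g.zero, sub_half]) (by simp [sub_half])
  simpa using congrFun this.1 θ

theorem add_pi (h₁ : 0 < a₁) (h₂ : 0 < a₂) (g : GroundState (weight a₁ a₂) mu c P) (θ : ℝ) :
    c (θ + π) = -c θ := by
  rw [← g.even h₁ h₂ θ, ← g.odd h₁ h₂ (-θ), sub_neg_eq_add, add_comm]

theorem periodic (h₁ : 0 < a₁) (h₂ : 0 < a₂) (g : GroundState (weight a₁ a₂) mu c P) :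
    Function.Periodic c (2 * π) := fun θ => by
  rw [two_mul, ← add_assoc, g.add_pi h₁ h₂, g.add_pi h₁ h₂, neg_neg]

theorem ne_zero (g : GroundState a mu c P) : c ≠ 0 := fun h => by
  have := g.pos 0 ⟨le_rfl, by positivity⟩
  simp [h] at this

theorem mem_eigenspace (h₁ : 0 < a₁) (h₂ : 0 < a₂) (g : GroundState (weight a₁ a₂) mu c P) :
    c ∈ eigenspace (weight a₁ a₂) mu :=
  (mem_eigenspace_iff (weight_pos h₁ h₂)).2 ⟨g.periodic h₁ h₂, P, g.solves⟩

theorem eq_zero_iff (h₁ : 0 < a₁) (h₂ : 0 < a₂) (g : GroundState (weight a₁ a₂) mu c P) {θ : ℝ}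
    (hθ : θ ∈ Ico 0 (2 * π)) : c θ = 0 ↔ θ = π / 2 ∨ θ = 3 * π / 2 := by
  have hpi := pi_pos
  obtain ⟨h0, h2⟩ := hθ
  constructor
  · intro hc
    by_contra! hne
    rcases hne.1.lt_or_gt with h | h
    · exact (g.pos θ ⟨h0, h⟩).ne' hc
    rcases hne.2.lt_or_gt with h' | h'
    · rcases le_total θ π with h'' | h''
      · have := g.pos (π - θ) ⟨by linarith, by linarith⟩
        rw [g.odd h₁ h₂, hc] at this
        simp at this
      · have := g.pos (θ - π) ⟨by linarith, by linarith⟩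
        rw [← neg_neg (c (θ - π)), ← g.add_pi h₁ h₂, sub_add_cancel, hc] at this
        simp at this
    · have := g.pos (2 * π - θ) ⟨by linarith, by linarith⟩
      rw [(g.periodic h₁ h₂).sub_eq', g.even h₁ h₂, hc] at this
      simp at this
  · rintro (rfl | rfl)
    · exact g.zero
    · rw [show 3 * π / 2 = π / 2 + π by ring, g.add_pi h₁ h₂, g.zero, neg_zero]

end GroundState

/-! ### Existence of the ground state by shooting -/

/-- If `a₂ ≤ a₁` then the solution for `lam = 1` has a zero in `[0, π / 2]`. -/
theorem exists_nonpos_of_solves_one {a₁ a₂ : ℝ} (h : a₂ ≤ a₁) (h₂ : 0 < a₂) {c P : ℝ → ℝ}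
    (hs : Solves (weight a₁ a₂) 1 c P) (hP : P 0 = 0) : ∃ θ ∈ Icc 0 (π / 2), c θ ≤ 0 := by
  by_contra! hc
  have ha := weight_pos (h₂.trans_le h) h₂
  -- This is the Wronskian a (c' cos - c cos'). As cos solves the equation with lam = 1 for a
  -- constant weight, only the term a' c sin survives, and a' ≤ 0 on the quarter circle. A positive
  -- `c` would make the Wronskian rise from 0 to a positive value.
  have hW : ∀ θ, HasDerivAt (fun t => P t * cos t + weight a₁ a₂ t * (c t * sin t))
      (2 * (a₂ - a₁) * (sin θ * cos θ) * (c θ * sin θ)) θ := by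
    intro θ
    refine (((hs θ).2.mul (hasDerivAt_cos θ)).add
      ((hasDerivAt_weight a₁ a₂ θ).mul ((hs θ).1.mul (hasDerivAt_sin θ)))).congr_deriv ?_
    have := (ha θ).ne'
    simp only [Pi.mul_apply]
    field_simp
    ring
  have hanti : AntitoneOn (fun t => P t * cos t + weight a₁ a₂ t * (c t * sin t))
      (Icc 0 (π / 2)) := by
    refine antitoneOn_of_deriv_nonpos (convex_Icc _ _)
      (fun t _ => (hW t).continuousAt.continuousWithinAt)
      (fun t _ => (hW t).differentiableAt.differentiableWithinAt) ?_
    rw [interior_Icc]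
    intro t ht
    rw [(hW t).deriv]
    have hsin : 0 < sin t := sin_pos_of_pos_of_lt_pi ht.1 (by linarith [ht.2, pi_pos])
    have hcos : 0 < cos t := cos_pos_of_mem_Ioo ⟨by linarith [ht.1, pi_pos], ht.2⟩
    have hct := hc t ⟨ht.1.le, ht.2.le⟩
    have : 0 ≤ (a₁ - a₂) * ((sin t * cos t) * (c t * sin t)) :=
      mul_nonneg (sub_nonneg.2 h) (by positivity)
    linarith
  have hpi : (0 : ℝ) ≤ π / 2 := by positivity
  have := hanti (left_mem_Icc.2 hpi) (right_mem_Icc.2 hpi) hpi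
  simp only [cos_pi_div_two, sin_pi_div_two, hP, sin_zero] at this
  nlinarith [ha (π / 2), hc (π / 2) (right_mem_Icc.2 hpi)]

/-- The parameter mu is the least lam in [0, 1] whose solution takes a value ≤ 0 on [0, π/2]. By
minimality the solution at mu is still nonnegative, hence nonincreasing, so its zero lies at π/2. -/
theorem exists_groundState {a₁ a₂ : ℝ} (h : a₂ ≤ a₁) (h₂ : 0 < a₂) :
    ∃ mu c P, GroundState (weight a₁ a₂) mu c P := by
  have h₁ := h₂.trans_le h
  have ha := weight_pos h₁ h₂
  obtain ⟨c, P, hs, hcont⟩ := exists_solves (continuous_weight a₁ a₂) ha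
    (weight_le h₁ h₂) (inv_weight_le h₁ h₂)
  have hpi : (0 : ℝ) ≤ π / 2 := by positivity
  have hsub : (Icc 0 1 ×ˢ Icc 0 (π / 2) : Set (ℝ × ℝ)) ⊆ Icc (-1) 1 ×ˢ Icc (-(π / 2)) (π / 2) :=
    prod_mono (Icc_subset_Icc (by norm_num) le_rfl) (Icc_subset_Icc (by linarith) le_rfl)
  -- Joint continuity makes the set of pairs (lam, θ) with c ≤ 0 compact, so its projection to lam
  -- attains its minimum.
  have hcomp : IsCompact ((Icc 0 1 ×ˢ Icc 0 (π / 2) : Set (ℝ × ℝ)) ∩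
      (fun z : ℝ × ℝ => c z.1 z.2) ⁻¹' Iic 0) :=
    (isCompact_Icc.prod isCompact_Icc).of_isClosed_subset
      (((hcont (π / 2)).mono hsub).preimage_isClosed_of_isClosed
        (isClosed_Icc.prod isClosed_Icc) isClosed_Iic) inter_subset_left
  have h1mem : (1 : ℝ) ∈ Icc (-1 : ℝ) 1 := by norm_num
  obtain ⟨θ₁, hθ₁, hc1⟩ := exists_nonpos_of_solves_one h h₂ (hs 1 h1mem).1 (hs 1 h1mem).2.2
  obtain ⟨mu, ⟨⟨mu', x⟩, ⟨⟨hmu, hx⟩, hcx⟩, rfl⟩, hleast⟩ :=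
    (hcomp.image continuous_fst).exists_isLeast ⟨1, (1, θ₁), ⟨⟨by norm_num, hθ₁⟩, hc1⟩, rfl⟩
  simp only at hmu hx hcx hleast
  have hmu' : mu' ∈ Icc (-1 : ℝ) 1 := ⟨by linarith [hmu.1], hmu.2⟩
  obtain ⟨hsol, hc0, hP0⟩ := hs mu' hmu'
  have hmupos : 0 < mu' := by
    refine hmu.1.lt_of_ne fun h0 => ?_
    subst h0
    have : Solves (weight a₁ a₂) 0 (fun _ => 1) (fun _ => 0) := fun θ => by
      simpa using ⟨hasDerivAt_const θ (1 : ℝ), hasDerivAt_const θ (0 : ℝ)⟩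
    have := congrFun (hsol.weight_unique h₁ h₂ this hc0 hP0).1 x
    have hcx' : c 0 x ≤ 0 := hcx
    linarith
  have hnonneg : ∀ θ ∈ Icc 0 (π / 2), 0 ≤ c mu' θ := by
    intro θ hθ
    -- For l < mu' minimality makes the solution positive; let l tend to mu' from below.
    have hcl : mu' ∈ closure (Ioo 0 mu') := by
      rw [closure_Ioo hmupos.ne]
      exact right_mem_Icc.2 hmupos.le
    have hco : ContinuousOn (fun l => c l θ) (Icc 0 1) :=
      (hcont (π / 2)).comp (f := fun l => (l, θ)) (by fun_prop) fun l hl => hsub ⟨hl, hθ⟩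
    have hnb : (𝓝[Ioo 0 mu'] mu').NeBot := mem_closure_iff_nhdsWithin_neBot.1 hcl
    refine ge_of_tendsto ((hco mu' hmu).mono_left (nhdsWithin_mono _
      (fun l hl => ⟨hl.1.le, hl.2.le.trans hmu.2⟩ : Ioo 0 mu' ⊆ Icc 0 1))) ?_
    filter_upwards [self_mem_nhdsWithin] with l hl
    by_contra! hneg
    have := hleast ⟨(l, θ), ⟨⟨⟨hl.1.le, hl.2.le.trans hmu.2⟩, hθ⟩, hneg.le⟩, rfl⟩
    exact absurd hl.2 (not_lt.2 this)
  have hPanti : AntitoneOn (P mu') (Icc 0 (π / 2)) := by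
    refine antitoneOn_of_deriv_nonpos (convex_Icc _ _) hsol.continuous_flux.continuousOn
      (fun t _ => (hsol t).2.differentiableAt.differentiableWithinAt) fun t ht => ?_
    rw [(hsol t).2.deriv]
    have := hnonneg t (interior_subset ht)
    have := ha t
    have : 0 ≤ mu' * (weight a₁ a₂ t * c mu' t) := by positivity
    linarith
  have hPnonpos : ∀ t ∈ Icc 0 (π / 2), P mu' t ≤ 0 := fun t ht => by
    rw [← hP0]
    exact hPanti (left_mem_Icc.2 hpi) ht ht.1
  have hcanti : AntitoneOn (c mu') (Icc 0 (π / 2)) := by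
    refine antitoneOn_of_deriv_nonpos (convex_Icc _ _) hsol.continuous.continuousOn
      (fun t _ => (hsol t).1.differentiableAt.differentiableWithinAt) fun t ht => ?_
    rw [(hsol t).1.deriv]
    exact div_nonpos_of_nonpos_of_nonneg (hPnonpos t (interior_subset ht)) (ha t).le
  have hpos : ∀ θ ∈ Ico 0 (π / 2), 0 < c mu' θ := by
    intro θ hθ
    refine (hnonneg θ ⟨hθ.1, hθ.2.le⟩).lt_of_ne fun h0 => ?_
    -- A zero before π/2 would persist up to π/2, because the solution is nonincreasing and
    -- nonnegative. On that interval the flux vanishes as well, which forces the trivial solution.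
    have hzero : ∀ t ∈ Icc θ (π / 2), c mu' t = 0 := fun t ht => le_antisymm
      (h0 ▸ hcanti ⟨hθ.1, hθ.2.le⟩ ⟨hθ.1.trans ht.1, ht.2⟩ ht.1)
      (hnonneg t ⟨hθ.1.trans ht.1, ht.2⟩)
    set m := (θ + π / 2) / 2 with hm
    have hmem : m ∈ Ioo θ (π / 2) := ⟨by linarith [hθ.2], by linarith [hθ.2]⟩
    have hev : c mu' =ᶠ[𝓝 m] fun _ => 0 := by
      filter_upwards [isOpen_Ioo.mem_nhds hmem] with t ht
      exact hzero t ⟨ht.1.le, ht.2.le⟩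
    have hd := ((hsol m).1.congr_of_eventuallyEq hev.symm).unique (hasDerivAt_const m (0 : ℝ))
    have hPm : P mu' m = 0 := (div_eq_zero_iff.1 hd).resolve_right (ha m).ne'
    have := congrFun (hsol.weight_eq_zero h₁ h₂ (hzero m ⟨hmem.1.le, hmem.2.le⟩) hPm).1 0
    rw [hc0] at this
    exact one_ne_zero this
  refine ⟨mu', c mu', P mu', hsol, hmupos, hP0, hpos, ?_⟩
  exact le_antisymm ((hcanti hx (right_mem_Icc.2 hpi) hx.2).trans hcx)
    (hnonneg _ (right_mem_Icc.2 hpi))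

/-! ### Picone's identity, Rayleigh quotients and comparison of weights -/

theorem le_of_monotoneOn_Ico {f : ℝ → ℝ} {x y l : ℝ} (hf : MonotoneOn f (Ico x y))
    (hl : Tendsto f (𝓝[<] y) (𝓝 l)) {t : ℝ} (ht : t ∈ Ico x y) : f t ≤ l := by
  refine ge_of_tendsto hl ?_
  filter_upwards [Ioo_mem_nhdsLT ht.2] with s hs
  exact hf ht ⟨ht.1.trans hs.1.le, hs.2⟩ hs.1.le

theorem monotoneOn_Ico_of_hasDerivAt {f f' : ℝ → ℝ} {x y : ℝ}
    (hf : ∀ t ∈ Ico x y, HasDerivAt f (f' t) t) (h0 : ∀ t ∈ Ico x y, 0 ≤ f' t) :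
    MonotoneOn f (Ico x y) := by
  refine monotoneOn_of_deriv_nonneg (convex_Ico _ _)
    (fun t ht => (hf t ht).continuousAt.continuousWithinAt)
    (fun t ht => (hf t (interior_subset ht)).differentiableAt.differentiableWithinAt)
    fun t ht => ?_
  rw [(hf t (interior_subset ht)).deriv]
  exact h0 t (interior_subset ht)

/-- The quotient of two functions with a common zero, the zero of the denominator being simple. -/
theorem tendsto_div_of_hasDerivAt {f g : ℝ → ℝ} {f' g' x : ℝ} (hf : HasDerivAt f f' x)
    (hg : HasDerivAt g g' x) (hfx : f x = 0) (hgx : g x = 0) (hg' : g' ≠ 0) :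
    Tendsto (fun t => f t / g t) (𝓝[<] x) (𝓝 (f' / g')) := by
  have hle : 𝓝[<] x ≤ 𝓝[≠] x := nhdsWithin_mono _ fun t ht => ne_of_lt ht
  refine ((hf.tendsto_slope.mono_left hle).div (hg.tendsto_slope.mono_left hle) hg').congr' ?_
  filter_upwards [self_mem_nhdsWithin] with t ht
  have : t - x ≠ 0 := sub_ne_zero.2 (ne_of_lt ht)
  rw [Pi.div_apply, slope_def_field, slope_def_field, hfx, hgx, sub_zero, sub_zero]
  field_simp

namespace GroundState

variable {a : ℝ → ℝ} {mu : ℝ} {c P : ℝ → ℝ}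

theorem tendsto_div (g : GroundState a mu c P) (ha : ∀ θ, 0 < a θ) {f : ℝ → ℝ} {f' : ℝ}
    (hf : HasDerivAt f f' (π / 2)) (h0 : f (π / 2) = 0) :
    ∃ l, Tendsto (fun t => f t / c t) (𝓝[<] (π / 2)) (𝓝 l) :=
  ⟨_, tendsto_div_of_hasDerivAt hf (g.solves _).1 h0 g.zero (div_ne_zero
    (g.flux_neg ha _ ⟨by positivity, le_rfl⟩).ne (ha _).ne')⟩

/-- Picone's identity against the ground state, for a solution on `[0, y]`. -/
theorem picone (g : GroundState a mu c P) (ha : ∀ θ, 0 < a θ) {lam : ℝ} {u p : ℝ → ℝ}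
    (hs : Solves a lam u p) (hl : lam ≤ mu) (h0 : u 0 * p 0 = 0) {y : ℝ} (hy : 0 < y)
    (hy' : y ≤ π / 2) (huy : u y = 0) :
    (∀ θ ∈ Icc 0 y, p θ * c θ - u θ * P θ = 0) ∧ (lam < mu → ∀ θ ∈ Ioo 0 y, u θ = 0) := by
  set W : ℝ → ℝ := fun θ => p θ * c θ - u θ * P θ with hW_def
  -- F' is a sum of two nonnegative terms and F vanishes at both ends, so both terms vanish. If y =
  -- π/2, then u / c keeps a finite limit there while the Wronskian W tends to 0.
  set F : ℝ → ℝ := fun θ => u θ / c θ * W θ with hF_def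
  have hc : ∀ θ ∈ Ico 0 y, 0 < c θ := fun θ hθ => g.pos θ ⟨hθ.1, hθ.2.trans_le hy'⟩
  have hW : ∀ θ, HasDerivAt W ((mu - lam) * (a θ * u θ * c θ)) θ := by
    intro θ
    refine (((hs θ).2.mul (g.solves θ).1).sub ((hs θ).1.mul (g.solves θ).2)).congr_deriv ?_
    ring
  have hWc : Continuous W := continuous_iff_continuousAt.2 fun θ => (hW θ).continuousAt
  have hF : ∀ θ ∈ Ico 0 y,
      HasDerivAt F (W θ ^ 2 / (a θ * c θ ^ 2) + (mu - lam) * (a θ * u θ ^ 2)) θ := by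
    intro θ hθ
    have hcθ := (hc θ hθ).ne'
    have haθ := (ha θ).ne'
    refine ((((hs θ).1.div (g.solves θ).1 hcθ)).mul (hW θ)).congr_deriv ?_
    simp only [hW_def, Pi.div_apply]
    field_simp
  have h1 : ∀ θ, θ ∈ Ico 0 y → 0 ≤ W θ ^ 2 / (a θ * c θ ^ 2) := fun θ hθ => by
    have := ha θ
    have := hc θ hθ
    positivity
  have h2 : ∀ θ, 0 ≤ (mu - lam) * (a θ * u θ ^ 2) := fun θ =>
    mul_nonneg (sub_nonneg.2 hl) (mul_nonneg (ha θ).le (sq_nonneg _))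
  have hmono := monotoneOn_Ico_of_hasDerivAt hF fun θ hθ => add_nonneg (h1 θ hθ) (h2 θ)
  have hlim : Tendsto F (𝓝[<] y) (𝓝 0) := by
    have hWy : Tendsto W (𝓝[<] y) (𝓝 (W y)) := (hWc.tendsto y).mono_left nhdsWithin_le_nhds
    rcases hy'.lt_or_eq with h | rfl
    · have hcy := (g.pos y ⟨hy.le, h⟩).ne'
      have hq : Tendsto (fun t => u t / c t) (𝓝[<] y) (𝓝 (u y / c y)) :=
        ((hs y).1.continuousAt.div (g.solves y).1.continuousAt hcy).tendsto.mono_left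
          nhdsWithin_le_nhds
      simpa [huy] using hq.mul hWy
    · obtain ⟨l, hq⟩ := g.tendsto_div ha (hs _).1 huy
      simpa [hW_def, huy, g.zero] using hq.mul hWy
  have hF0 : F 0 = 0 := by
    have := (hc 0 ⟨le_rfl, hy⟩).ne'
    simp only [hF_def, hW_def, g.flux_zero]
    field_simp
    linear_combination c 0 * h0
  have hFz : ∀ θ ∈ Ico 0 y, F θ = 0 := fun θ hθ => le_antisymm (le_of_monotoneOn_Ico hmono hlim hθ)
    (hF0 ▸ hmono ⟨le_rfl, hy⟩ hθ hθ.1)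
  have hd : ∀ θ ∈ Ioo 0 y, W θ ^ 2 / (a θ * c θ ^ 2) + (mu - lam) * (a θ * u θ ^ 2) = 0 := by
    intro θ hθ
    have hev : F =ᶠ[𝓝 θ] fun _ => 0 := by
      filter_upwards [isOpen_Ioo.mem_nhds hθ] with t ht
      exact hFz t ⟨ht.1.le, ht.2⟩
    exact ((hF θ ⟨hθ.1.le, hθ.2⟩).congr_of_eventuallyEq hev.symm).unique
      (hasDerivAt_const θ (0 : ℝ))
  refine ⟨?_, fun hlt θ hθ => ?_⟩
  · have heq : EqOn W (fun _ => 0) (Ioo 0 y) := by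
      intro θ hθ
      have hθ' : θ ∈ Ico 0 y := ⟨hθ.1.le, hθ.2⟩
      have h3 : W θ ^ 2 / (a θ * c θ ^ 2) = 0 :=
        le_antisymm (by linarith [hd θ hθ, h2 θ]) (h1 θ hθ')
      have h4 : a θ * c θ ^ 2 ≠ 0 := mul_ne_zero (ha θ).ne' (pow_ne_zero _ (hc θ hθ').ne')
      exact pow_eq_zero_iff two_ne_zero |>.1 ((div_eq_zero_iff.1 h3).resolve_right h4)
    have := heq.closure hWc continuous_const
    rw [closure_Ioo hy.ne] at this
    exact fun θ hθ => this hθ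
  · have h3 : (mu - lam) * (a θ * u θ ^ 2) = 0 :=
      le_antisymm (by linarith [hd θ hθ, h1 θ ⟨hθ.1.le, hθ.2⟩]) (h2 θ)
    have h4 := (mul_eq_zero.1 h3).resolve_left (sub_pos.2 hlt).ne'
    exact pow_eq_zero_iff two_ne_zero |>.1 ((mul_eq_zero.1 h4).resolve_left (ha θ).ne')

/-- The Rayleigh quotient of a test function that vanishes at `π / 2` bounds the ground state
eigenvalue; `E` and `M` are primitives of `a φ' ^ 2` and of `a φ ^ 2`. -/
theorem mul_le_of_rayleigh (g : GroundState a mu c P) (ha : ∀ θ, 0 < a θ)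
    {φ φ' E M : ℝ → ℝ} {e m : ℝ} (hφ : ∀ θ, HasDerivAt φ (φ' θ) θ) (hφ0 : φ (π / 2) = 0)
    (hE : ∀ θ ∈ Ico 0 (π / 2), HasDerivAt E (a θ * φ' θ ^ 2) θ)
    (hM : ∀ θ ∈ Ico 0 (π / 2), HasDerivAt M (a θ * φ θ ^ 2) θ) (hE0 : E 0 = 0) (hM0 : M 0 = 0)
    (he : Tendsto E (𝓝[<] (π / 2)) (𝓝 e)) (hm : Tendsto M (𝓝[<] (π / 2)) (𝓝 m)) :
    mu * m ≤ e := by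
  -- Jacobi's completion of the square: G' = a (φ' - φ c'/c)². The boundary term vanishes at 0
  -- because P does, and at π/2 because φ does and φ / c stays bounded.
  set G : ℝ → ℝ := fun θ => E θ - mu * M θ - φ θ / c θ * (φ θ * P θ) with hG_def
  have hG : ∀ θ ∈ Ico 0 (π / 2),
      HasDerivAt G ((a θ * φ' θ * c θ - φ θ * P θ) ^ 2 / (a θ * c θ ^ 2)) θ := by
    intro θ hθ
    have hcθ := (g.pos θ hθ).ne'
    have haθ := (ha θ).ne'
    refine (((hE θ hθ).sub ((hM θ hθ).const_mul mu)).sub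
      (((hφ θ).div (g.solves θ).1 hcθ).mul ((hφ θ).mul (g.solves θ).2))).congr_deriv ?_
    simp only [Pi.div_apply, Pi.mul_apply]
    field_simp
    ring
  have hmono := monotoneOn_Ico_of_hasDerivAt hG fun θ hθ => by
    have := ha θ
    positivity
  obtain ⟨l, hl⟩ := g.tendsto_div ha (hφ _) hφ0
  have hφP : Tendsto (fun θ => φ θ * P θ) (𝓝[<] (π / 2)) (𝓝 (φ (π / 2) * P (π / 2))) :=
    ((hφ _).continuousAt.mul (g.solves _).2.continuousAt).tendsto.mono_left nhdsWithin_le_nhds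
  have hlim : Tendsto G (𝓝[<] (π / 2)) (𝓝 (e - mu * m)) := by
    simpa [hφ0] using (he.sub (hm.const_mul mu)).sub (hl.mul hφP)
  have := le_of_monotoneOn_Ico hmono hlim ⟨le_rfl, by positivity⟩
  simp only [hG_def, hE0, hM0, g.flux_zero] at this
  linarith

/-- The eigenvalue of the ground state decreases strictly with the ratio of the coefficients. -/
theorem compare {p₁ p₂ q₁ q₂ lam : ℝ} {d Q : ℝ → ℝ} (hp₁ : 0 < p₁) (hp₂ : 0 < p₂) (hq₁ : 0 < q₁)
    (hq₂ : 0 < q₂) (hD : q₁ * p₂ ≤ p₁ * q₂) (g : GroundState (weight p₁ p₂) mu c P)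
    (k : GroundState (weight q₁ q₂) lam d Q) (hl : lam ≤ mu) :
    lam = mu ∧ q₁ * p₂ = p₁ * q₂ := by
  have hp := weight_pos hp₁ hp₂
  have hq := weight_pos hq₁ hq₂
  have hpi : (0 : ℝ) < π / 2 := by positivity
  -- With p and q the two weights, this is p (c' d - c d'): the flux of d is converted to the weight
  -- p, so that only the derivative of p / q enters. Both terms of W' are nonpositive inside the
  -- interval, and W vanishes at both ends.
  set W : ℝ → ℝ := fun θ => P θ * d θ - c θ * (weight p₁ p₂ θ / weight q₁ q₂ θ * Q θ) with hW_def
  set W' : ℝ → ℝ := fun θ => (lam - mu) * (weight p₁ p₂ θ * c θ * d θ) +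
    (p₁ * q₂ - q₁ * p₂) * (2 * (sin θ * cos θ) * c θ * Q θ / weight q₁ q₂ θ ^ 2) with hW'_def
  have hW : ∀ θ, HasDerivAt W (W' θ) θ := by
    intro θ
    have h1 := (hp θ).ne'
    have h2 := (hq θ).ne'
    refine (((g.solves θ).2.mul (k.solves θ).1).sub ((g.solves θ).1.mul
      (((hasDerivAt_weight p₁ p₂ θ).div (hasDerivAt_weight q₁ q₂ θ) h2).mul
        (k.solves θ).2))).congr_deriv ?_
    have h3 : 2 * (p₂ - p₁) * (sin θ * cos θ) * weight q₁ q₂ θ -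
        weight p₁ p₂ θ * (2 * (q₂ - q₁) * (sin θ * cos θ)) =
        -(2 * (sin θ * cos θ) * (p₁ * q₂ - q₁ * p₂)) := by
      have := sin_sq_add_cos_sq θ
      unfold weight
      linear_combination (-(2 * (sin θ * cos θ) * (p₁ * q₂ - q₁ * p₂))) * this
    simp only [hW'_def, Pi.div_apply, Pi.mul_apply, h3]
    field_simp
    ring
  have hW0 : W 0 = 0 := by simp [hW_def, g.flux_zero, k.flux_zero]
  have hW1 : W (π / 2) = 0 := by simp [hW_def, g.zero, k.zero]
  have hneg1 : ∀ θ ∈ Ioo 0 (π / 2), 0 < weight p₁ p₂ θ * c θ * d θ := fun θ hθ =>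
    mul_pos (mul_pos (hp θ) (g.pos θ ⟨hθ.1.le, hθ.2⟩)) (k.pos θ ⟨hθ.1.le, hθ.2⟩)
  have hneg2 : ∀ θ ∈ Ioo 0 (π / 2),
      2 * (sin θ * cos θ) * c θ * Q θ / weight q₁ q₂ θ ^ 2 < 0 := fun θ hθ => by
    have hsin : 0 < sin θ := sin_pos_of_pos_of_lt_pi hθ.1 (by linarith [hθ.2])
    have hcos : 0 < cos θ := cos_pos_of_mem_Ioo ⟨by linarith [hθ.1], hθ.2⟩
    have hc := g.pos θ ⟨hθ.1.le, hθ.2⟩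
    have hQ := k.flux_neg hq θ ⟨hθ.1, hθ.2.le⟩
    exact div_neg_of_neg_of_pos (mul_neg_of_pos_of_neg (by positivity) hQ) (pow_pos (hq θ) 2)
  have h1 : ∀ θ ∈ Ioo 0 (π / 2), (lam - mu) * (weight p₁ p₂ θ * c θ * d θ) ≤ 0 := fun θ hθ =>
    mul_nonpos_of_nonpos_of_nonneg (sub_nonpos.2 hl) (hneg1 θ hθ).le
  have h2 : ∀ θ ∈ Ioo 0 (π / 2), (p₁ * q₂ - q₁ * p₂) *
      (2 * (sin θ * cos θ) * c θ * Q θ / weight q₁ q₂ θ ^ 2) ≤ 0 := fun θ hθ =>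
    mul_nonpos_of_nonneg_of_nonpos (sub_nonneg.2 hD) (hneg2 θ hθ).le
  have hanti : AntitoneOn W (Icc 0 (π / 2)) := by
    refine antitoneOn_of_deriv_nonpos (convex_Icc _ _)
      (fun t _ => (hW t).continuousAt.continuousWithinAt)
      (fun t _ => (hW t).differentiableAt.differentiableWithinAt) fun t ht => ?_
    rw [interior_Icc] at ht
    rw [(hW t).deriv]
    exact add_nonpos (h1 t ht) (h2 t ht)
  have hWz : ∀ θ ∈ Icc 0 (π / 2), W θ = 0 := fun θ hθ => le_antisymm
    (hW0 ▸ hanti (left_mem_Icc.2 hpi.le) hθ hθ.1) (hW1 ▸ hanti hθ (right_mem_Icc.2 hpi.le) hθ.2)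
  -- Any interior point serves: both terms of W' vanish there, while their second factors do not.
  have hx : π / 4 ∈ Ioo 0 (π / 2) := ⟨by positivity, by linarith⟩
  have hev : W =ᶠ[𝓝 (π / 4)] fun _ => 0 := by
    filter_upwards [isOpen_Ioo.mem_nhds hx] with t ht
    exact hWz t ⟨ht.1.le, ht.2.le⟩
  have hd : W' (π / 4) = 0 := ((hW _).congr_of_eventuallyEq hev.symm).unique
    (hasDerivAt_const _ (0 : ℝ))
  simp only [hW'_def] at hd
  constructor
  · have h3 := le_antisymm (h1 _ hx) (by linarith [h2 _ hx])
    exact sub_eq_zero.1 ((mul_eq_zero.1 h3).resolve_right (hneg1 _ hx).ne')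
  · have h3 := le_antisymm (h2 _ hx) (by linarith [h1 _ hx])
    exact (sub_eq_zero.1 ((mul_eq_zero.1 h3).resolve_right (hneg2 _ hx).ne)).symm

end GroundState

/-! ### Eigenfunctions on the circle -/

theorem weight_periodic (a₁ a₂ : ℝ) : Function.Periodic (weight a₁ a₂) (2 * π) := fun θ => by
  simp [weight]

namespace Solves

theorem flux_periodic {a : ℝ → ℝ} {lam T : ℝ} {u p : ℝ → ℝ} (ha : ∀ θ, 0 < a θ)
    (hT : Function.Periodic a T) (hs : Solves a lam u p) (hu : Function.Periodic u T) :
    Function.Periodic p T := by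
  intro θ
  have h1 : HasDerivAt (fun t => u (t + T)) (p (θ + T) / a (θ + T)) θ :=
    (hs (θ + T)).1.comp_add_const θ T
  have h2 : (fun t => u (t + T)) = u := funext hu
  rw [h2, hT] at h1
  exact (div_left_inj' (ha θ).ne').1 (h1.unique (hs θ).1)

/-- For lam < 0 the derivative of u p is a sum of two nonnegative terms. Periodicity makes u p
constant, so u and p both vanish at a point. -/
theorem pos_of_periodic {a₁ a₂ lam : ℝ} {u p : ℝ → ℝ} (h₁ : 0 < a₁) (h₂ : 0 < a₂)
    (hs : Solves (weight a₁ a₂) lam u p) (hu : Function.Periodic u (2 * π)) (hl : lam ≠ 0)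
    (hne : u ≠ 0) : 0 < lam := by
  by_contra! hle
  have hneg := hle.lt_of_ne hl
  have ha := weight_pos h₁ h₂
  have hp := hs.flux_periodic ha (weight_periodic a₁ a₂) hu
  have hpi : (0 : ℝ) < 2 * π := by positivity
  have hF : ∀ θ, HasDerivAt (fun t => u t * p t)
      (p θ ^ 2 / weight a₁ a₂ θ + -lam * (weight a₁ a₂ θ * u θ ^ 2)) θ := fun θ => by
    refine ((hs θ).1.mul (hs θ).2).congr_deriv ?_
    ring
  have h1 : ∀ θ, 0 ≤ p θ ^ 2 / weight a₁ a₂ θ := fun θ => div_nonneg (sq_nonneg _) (ha θ).le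
  have h2 : ∀ θ, 0 ≤ -lam * (weight a₁ a₂ θ * u θ ^ 2) := fun θ =>
    mul_nonneg (neg_pos.2 hneg).le (mul_nonneg (ha θ).le (sq_nonneg _))
  have hmono : Monotone fun t => u t * p t :=
    monotone_of_deriv_nonneg (fun t => (hF t).differentiableAt) fun t => by
      rw [(hF t).deriv]
      exact add_nonneg (h1 t) (h2 t)
  have hconst : ∀ t ∈ Ioo 0 (2 * π), u t * p t = u 0 * p 0 := fun t ht => by
    refine le_antisymm ((hmono ht.2.le).trans_eq ?_) (hmono ht.1.le)
    have e1 := hu 0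
    have e2 := hp 0
    rw [zero_add] at e1 e2
    simp only [e1, e2]
  have hx : π ∈ Ioo 0 (2 * π) := ⟨pi_pos, by linarith⟩
  have hev : (fun t => u t * p t) =ᶠ[𝓝 π] fun _ => u 0 * p 0 := by
    filter_upwards [isOpen_Ioo.mem_nhds hx] with t ht
    exact hconst t ht
  have hd := ((hF π).congr_of_eventuallyEq hev.symm).unique (hasDerivAt_const _ _)
  have h3 := (div_eq_zero_iff.1 (le_antisymm (by linarith [h2 π]) (h1 π))).resolve_right (ha π).ne'
  have h4 := (mul_eq_zero.1 (le_antisymm (by linarith [h1 π]) (h2 π))).resolve_left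
    (neg_pos.2 hneg).ne'
  have h5 := (mul_eq_zero.1 h4).resolve_left (ha π).ne'
  exact hne (hs.weight_eq_zero h₁ h₂ (pow_eq_zero_iff two_ne_zero |>.1 h5)
    (pow_eq_zero_iff two_ne_zero |>.1 h3)).1

end Solves

namespace GroundState

variable {a₁ a₂ mu lam : ℝ} {c P u p : ℝ → ℝ}

/-- The Wronskian with `c` vanishes by Picone; evaluated at 0 it is p(0) c(0), so u has zero data
there. -/
theorem eq_zero_of_dirichlet (h₁ : 0 < a₁) (h₂ : 0 < a₂) (g : GroundState (weight a₁ a₂) mu c P)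
    (hs : Solves (weight a₁ a₂) lam u p) (hl : lam ≤ mu) (h0 : u 0 = 0) {y : ℝ}
    (hy : y ∈ Ioc 0 (π / 2)) (huy : u y = 0) : u = 0 := by
  have h := (g.picone (weight_pos h₁ h₂) hs hl (by simp [h0]) hy.1 hy.2 huy).1 0
    (left_mem_Icc.2 hy.1.le)
  have hc := (g.pos 0 ⟨le_rfl, by positivity⟩).ne'
  rw [g.flux_zero, mul_zero, sub_zero] at h
  exact (hs.weight_eq_zero h₁ h₂ h0 ((mul_eq_zero.1 h).resolve_right hc)).1

theorem eq_zero_of_neumann (h₁ : 0 < a₁) (h₂ : 0 < a₂) (g : GroundState (weight a₁ a₂) mu c P)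
    (hs : Solves (weight a₁ a₂) lam u p) (hl : lam ≤ mu) (h0 : p 0 = 0) {y : ℝ}
    (hy : y ∈ Ioo 0 (π / 2)) (huy : u y = 0) : u = 0 := by
  have h := (g.picone (weight_pos h₁ h₂) hs hl (by simp [h0]) hy.1 hy.2.le huy).1 y
    (right_mem_Icc.2 hy.1.le)
  have hc := (g.pos y ⟨hy.1.le, hy.2⟩).ne'
  rw [huy, zero_mul, sub_zero] at h
  exact (hs.weight_eq_zero h₁ h₂ huy ((mul_eq_zero.1 h).resolve_right hc)).1

/-- Rolle's theorem applied to the flux gives an interior zero of u, which reduces to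
`eq_zero_of_neumann`. -/
theorem eq_zero_of_neumann_neumann (h₁ : 0 < a₁) (h₂ : 0 < a₂)
    (g : GroundState (weight a₁ a₂) mu c P) (hs : Solves (weight a₁ a₂) lam u p) (hl : lam ≤ mu)
    (hl0 : 0 < lam) (h0 : p 0 = 0) (h1 : p (π / 2) = 0) : u = 0 := by
  obtain ⟨z, hz, hz'⟩ := exists_hasDerivAt_eq_zero (f := p) (by positivity : (0 : ℝ) < π / 2)
    hs.continuous_flux.continuousOn (h0.trans h1.symm) fun x _ => (hs x).2
  refine g.eq_zero_of_neumann h₁ h₂ hs hl h0 hz ?_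
  have := (mul_eq_zero.1 (neg_eq_zero.1 hz')).resolve_left hl0.ne'
  exact (mul_eq_zero.1 this).resolve_left (weight_pos h₁ h₂ z).ne'

theorem eq_zero_of_lt (h₁ : 0 < a₁) (h₂ : 0 < a₂) (g : GroundState (weight a₁ a₂) mu c P)
    (hs : Solves (weight a₁ a₂) lam u p) (hl : lam < mu) (h0 : p 0 = 0) (h1 : u (π / 2) = 0) :
    u = 0 := by
  have hx : π / 4 ∈ Ioo 0 (π / 2) := ⟨by positivity, by linarith [pi_pos]⟩
  exact g.eq_zero_of_neumann h₁ h₂ hs hl.le h0 hx ((g.picone (weight_pos h₁ h₂) hs hl.le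
    (by simp [h0]) (by positivity) le_rfl h1).2 hl _ hx)

/-- A nonzero u has no zero in (0, π/2], hence its reflection about π/4 is, up to a factor, a ground
state for the swapped weight. `compare` then gives lam = mu and a₁² = a₂². -/
theorem eq_zero_of_dirichlet_neumann (h : a₂ ≤ a₁) (h₂ : 0 < a₂)
    (g : GroundState (weight a₁ a₂) mu c P) (hs : Solves (weight a₁ a₂) lam u p) (hl : lam ≤ mu)
    (hl0 : 0 < lam) (hor : lam < mu ∨ a₂ < a₁) (h0 : u 0 = 0) (h1 : p (π / 2) = 0) : u = 0 := by
  have h₁ := h₂.trans_le h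
  have hpi : (0 : ℝ) < π / 2 := by positivity
  by_contra hne
  have hz : ∀ y ∈ Ioc 0 (π / 2), u y ≠ 0 := fun y hy huy =>
    hne (g.eq_zero_of_dirichlet h₁ h₂ hs hl h0 hy huy)
  set k := (u (π / 2))⁻¹ with hk
  have hk1 : k * u (π / 2) = 1 := inv_mul_cancel₀ (hz _ (right_mem_Ioc.2 hpi))
  have hk0 : k ≠ 0 := left_ne_zero_of_mul_eq_one hk1
  have hpos : ∀ y ∈ Ioc 0 (π / 2), 0 < k * u y := by
    intro y hy
    by_contra! hneg
    have hsub : Icc (k * u y) (k * u (π / 2)) ⊆ (fun t => k * u t) '' Icc y (π / 2) :=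
      intermediate_value_Icc hy.2 (continuous_const.mul hs.continuous).continuousOn
    obtain ⟨z, hzm, hz0⟩ := hsub ⟨hneg, hk1 ▸ zero_le_one⟩
    exact hz z ⟨hy.1.trans_le hzm.1, hzm.2⟩ ((mul_eq_zero.1 hz0).resolve_left hk0)
  have hg : GroundState (weight a₂ a₁) lam (fun θ => k * u (π / 2 - θ))
      (fun θ => -(k * p (π / 2 - θ))) := by
    refine ⟨(hs.const_mul k).reflect (π / 2) (weight_pi_div_two_sub a₁ a₂), hl0, by simp [h1],
      fun θ hθ => hpos _ ⟨by linarith [hθ.2], by linarith [hθ.1]⟩, by simp [h0]⟩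
  obtain ⟨e1, e2⟩ := compare h₁ h₂ h₂ h₁ (by nlinarith) g hg hl
  rcases hor with hlt | hlt
  · exact hlt.ne e1
  · nlinarith

/-- Up to the ground state eigenvalue, eigenfunctions on the circle are multiples of the ground
state. -/
theorem eigenfunction_eq (h : a₂ ≤ a₁) (h₂ : 0 < a₂) (g : GroundState (weight a₁ a₂) mu c P)
    (hl : lam ≤ mu) (hl0 : 0 < lam) (hor : lam < mu ∨ a₂ < a₁)
    (hu : u ∈ eigenspace (weight a₁ a₂) lam) : (lam < mu → u = 0) ∧ ∃ k : ℝ, u = k • c := by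
  have h₁ := h₂.trans_le h
  obtain ⟨hper, p, hs⟩ := (mem_eigenspace_iff (weight_pos h₁ h₂)).1 hu
  have hpper := hs.flux_periodic (weight_pos h₁ h₂) (weight_periodic a₁ a₂) hper
  -- Periodicity enters the decomposition here: it yields the conditions at 0 for the parts
  -- symmetrized about π/2, which involve the values at π and -π.
  have eu : u (-π) = u π := by rw [← hper (-π)]; congr 1; ring
  have ep : p (-π) = p π := by rw [← hpper (-π)]; congr 1; ring
  have hsr := hs.reflect 0 (weight_neg a₁ a₂)
  have hE := hs.add hsr
  have hO := hs.add (hsr.const_mul (-1))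
  have hEr := hE.reflect π (weight_pi_sub a₁ a₂)
  have hOr := hO.reflect π (weight_pi_sub a₁ a₂)
  have z1 := g.eq_zero_of_neumann_neumann h₁ h₂ (hE.add hEr) hl hl0 (by simp [ep])
    (by simp [sub_half])
  have z2 := g.eq_zero_of_dirichlet h₁ h₂ (hO.add (hOr.const_mul (-1))) hl (by simp [eu])
    (y := π / 2) ⟨by positivity, le_rfl⟩ (by simp [sub_half])
  have z3 := g.eq_zero_of_dirichlet_neumann h h₂ (hO.add hOr) hl hl0 hor (by simp [eu])
    (by simp [sub_half])
  have hEO := hE.add (hEr.const_mul (-1))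
  -- Four times the part even about 0 and odd about π/2. The other three parts vanish, so u = w / 4.
  set w : ℝ → ℝ := fun θ => u θ + u (0 - θ) + -1 * (u (π - θ) + u (0 - (π - θ))) with hw
  have hsum : ∀ θ, u θ = 4⁻¹ * w θ := by
    intro θ
    have e1 := congrFun z1 θ
    have e2 := congrFun z2 θ
    have e3 := congrFun z3 θ
    simp only [Pi.zero_apply] at e1 e2 e3
    simp only [hw]
    linarith
  have hP0 : p 0 + -p (0 - 0) + -1 * -(p (π - 0) + -p (0 - (π - 0))) = 0 := by simp [ep]
  have hw1 : w (π / 2) = 0 := by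
    simp only [hw, sub_half]
    ring
  have hlt : lam < mu → u = 0 := fun hlt => by
    have hw0 : w = 0 := g.eq_zero_of_lt h₁ h₂ hEO hlt hP0 hw1
    funext θ
    rw [hsum, hw0]
    simp
  refine ⟨hlt, ?_⟩
  rcases hl.lt_or_eq with hlt' | rfl
  · exact ⟨0, by rw [hlt hlt', zero_smul]⟩
  · have hc := (g.pos 0 ⟨le_rfl, by positivity⟩).ne'
    have := hEO.weight_unique h₁ h₂ (g.solves.const_mul (w 0 / c 0)) (x := 0)
      (by rw [div_mul_cancel₀ _ hc]) (by rw [g.flux_zero, mul_zero]; exact hP0)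
    refine ⟨4⁻¹ * (w 0 / c 0), funext fun θ => ?_⟩
    have e : w θ = w 0 / c 0 * c θ := congrFun this.1 θ
    rw [hsum, e, Pi.smul_apply, smul_eq_mul, mul_assoc]

theorem isLeast (h : a₂ ≤ a₁) (h₂ : 0 < a₂) (g : GroundState (weight a₁ a₂) mu c P) :
    IsLeast (nonzeroEigenvalues (weight a₁ a₂)) mu := by
  have h₁ := h₂.trans_le h
  refine ⟨⟨g.mu_pos.ne', c, g.mem_eigenspace h₁ h₂, g.ne_zero⟩, ?_⟩
  rintro lam ⟨hl0, u, hu, hne⟩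
  by_contra! hlt
  obtain ⟨hper, p, hs⟩ := (mem_eigenspace_iff (weight_pos h₁ h₂)).1 hu
  exact hne ((g.eigenfunction_eq h h₂ hlt.le (hs.pos_of_periodic h₁ h₂ hper hl0 hne) (.inl hlt)
    hu).1 hlt)

theorem lambda₁_eq (h : a₂ ≤ a₁) (h₂ : 0 < a₂) (g : GroundState (weight a₁ a₂) mu c P) :
    lambda₁ (weight a₁ a₂) = mu :=
  (g.isLeast h h₂).csInf_eq

theorem mem_eigenspace_iff_exists (h : a₂ < a₁) (h₂ : 0 < a₂)
    (g : GroundState (weight a₁ a₂) mu c P) :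
    u ∈ eigenspace (weight a₁ a₂) mu ↔ ∃ k : ℝ, u = k • c := by
  refine ⟨fun hu => (g.eigenfunction_eq h.le h₂ le_rfl g.mu_pos (.inr h) hu).2, ?_⟩
  rintro ⟨k, rfl⟩
  exact Submodule.smul_mem _ k (g.mem_eigenspace (h₂.trans h) h₂)

theorem scale {k : ℝ} (hk : 0 < k) (g : GroundState (weight a₁ a₂) mu c P) :
    GroundState (weight (k * a₁) (k * a₂)) mu c (fun θ => k * P θ) := by
  have hw : ∀ θ, weight (k * a₁) (k * a₂) θ = k * weight a₁ a₂ θ := fun θ => by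
    unfold weight
    ring
  refine ⟨fun θ => ⟨?_, ?_⟩, g.mu_pos, by simp [g.flux_zero], g.pos, g.zero⟩
  · rw [hw, mul_div_mul_left _ _ hk.ne']
    exact (g.solves θ).1
  · refine ((g.solves θ).2.const_mul k).congr_deriv ?_
    rw [hw]
    ring

end GroundState

/-! ### Dependence on the ratio of the coefficients -/

theorem lambda₁_weight_eq {a₁ a₂ : ℝ} (h : a₂ ≤ a₁) (h₂ : 0 < a₂) :
    lambda₁ (weight a₁ a₂) = lambda₁ (weight (a₁ / a₂) 1) := by
  obtain ⟨mu, c, P, g⟩ := exists_groundState h h₂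
  have g' := g.scale (inv_pos.2 h₂)
  rw [inv_mul_cancel₀ h₂.ne', ← div_eq_inv_mul] at g'
  rw [g.lambda₁_eq h h₂, g'.lambda₁_eq ((one_le_div h₂).2 h) one_pos]

theorem strictAntiOn_lambda₁ : StrictAntiOn (fun r => lambda₁ (weight r 1)) (Ici 1) := by
  intro r hr s hs hrs
  obtain ⟨mu, c, P, g⟩ := exists_groundState (mem_Ici.1 hs) one_pos
  obtain ⟨lam, d, Q, k⟩ := exists_groundState (mem_Ici.1 hr) one_pos
  simp only [g.lambda₁_eq hs one_pos, k.lambda₁_eq hr one_pos]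
  by_contra! hle
  have hr0 : 0 < r := one_pos.trans_le hr
  have := (g.compare (hr0.trans hrs) one_pos hr0 one_pos (by linarith) k hle).2
  linarith

/-! ### Explicit bounds -/

theorem hasDerivAt_arctan_mul_tan {r₁ r₂ θ : ℝ} (h₁ : 0 < r₁) (h₂ : 0 < r₂) (hθ : cos θ ≠ 0) :
    HasDerivAt (fun t => arctan (r₂ / r₁ * tan t)) (r₁ * r₂ / weight (r₁ ^ 2) (r₂ ^ 2) θ) θ := by
  refine ((hasDerivAt_tan hθ).const_mul (r₂ / r₁)).arctan.congr_deriv ?_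
  have hw : r₁ ^ 2 * cos θ ^ 2 + r₂ ^ 2 * sin θ ^ 2 ≠ 0 := by positivity
  rw [tan_eq_sin_div_cos, weight]
  field_simp

theorem tendsto_arctan_mul_tan {k : ℝ} (hk : 0 < k) :
    Tendsto (fun t => arctan (k * tan t)) (𝓝[<] (π / 2)) (𝓝 (π / 2)) :=
  (tendsto_arctan_atTop.mono_right nhdsWithin_le_nhds).comp
    (tendsto_tan_pi_div_two.const_mul_atTop hk)

namespace GroundState

variable {a₁ a₂ mu : ℝ} {c P : ℝ → ℝ}

/-- The test function cos θ has energy ∫ a sin² = (a₁ + 3a₂)π/16 and mass ∫ a cos² = (3a₁ + a₂)π/16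
on the quarter circle. -/
theorem mu_le_div (h₁ : 0 < a₁) (h₂ : 0 < a₂) (g : GroundState (weight a₁ a₂) mu c P) :
    mu ≤ (a₁ + 3 * a₂) / (3 * a₁ + a₂) := by
  have hsk : ∀ θ, HasDerivAt (fun t => sin t * cos t) (cos θ ^ 2 - sin θ ^ 2) θ := fun θ =>
    ((hasDerivAt_sin θ).mul (hasDerivAt_cos θ)).congr_deriv (by ring)
  have hs3 : ∀ θ, HasDerivAt (fun t => sin t ^ 3 * cos t)
      (3 * sin θ ^ 2 * cos θ ^ 2 - sin θ ^ 4) θ := fun θ =>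
    (((hasDerivAt_sin θ).pow 3).mul (hasDerivAt_cos θ)).congr_deriv (by simp; ring)
  have hk3 : ∀ θ, HasDerivAt (fun t => sin t * cos t ^ 3)
      (cos θ ^ 4 - 3 * sin θ ^ 2 * cos θ ^ 2) θ := fun θ =>
    ((hasDerivAt_sin θ).mul ((hasDerivAt_cos θ).pow 3)).congr_deriv (by simp; ring)
  set E : ℝ → ℝ := fun t => a₁ / 8 * (t - (sin t * cos t ^ 3 - sin t ^ 3 * cos t)) +
    a₂ * (3 / 8 * t - 3 / 8 * (sin t * cos t) - 1 / 4 * (sin t ^ 3 * cos t)) with hE_def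
  set M : ℝ → ℝ := fun t =>
    a₁ * (3 / 8 * t + 3 / 8 * (sin t * cos t) + 1 / 4 * (sin t * cos t ^ 3)) +
    a₂ / 8 * (t - (sin t * cos t ^ 3 - sin t ^ 3 * cos t)) with hM_def
  have hE : ∀ θ, HasDerivAt E (weight a₁ a₂ θ * (-sin θ) ^ 2) θ := fun θ => by
    refine ((((hasDerivAt_id θ).sub ((hk3 θ).sub (hs3 θ))).const_mul (a₁ / 8)).add
      (((((hasDerivAt_id θ).const_mul (3 / 8)).sub ((hsk θ).const_mul (3 / 8))).sub
        ((hs3 θ).const_mul (1 / 4))).const_mul a₂)).congr_deriv ?_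
    unfold weight
    linear_combination (-(a₁ / 8 + a₂ * 3 / 8) * (sin θ ^ 2 + cos θ ^ 2 + 1) +
      a₂ * 3 / 8 * (cos θ ^ 2 - sin θ ^ 2)) * sin_sq_add_cos_sq θ
  have hM : ∀ θ, HasDerivAt M (weight a₁ a₂ θ * cos θ ^ 2) θ := fun θ => by
    refine ((((((hasDerivAt_id θ).const_mul (3 / 8)).add ((hsk θ).const_mul (3 / 8))).add
        ((hk3 θ).const_mul (1 / 4))).const_mul a₁).add
        (((hasDerivAt_id θ).sub ((hk3 θ).sub (hs3 θ))).const_mul (a₂ / 8))).congr_deriv ?_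
    unfold weight
    linear_combination (-(a₁ * 3 / 8 + a₂ / 8) * (sin θ ^ 2 + cos θ ^ 2 + 1) -
      a₁ * 3 / 8 * (cos θ ^ 2 - sin θ ^ 2)) * sin_sq_add_cos_sq θ
  have := g.mul_le_of_rayleigh (weight_pos h₁ h₂) hasDerivAt_cos cos_pi_div_two
    (fun θ _ => hE θ) (fun θ _ => hM θ) (by simp [hE_def]) (by simp [hM_def])
    ((hE _).continuousAt.tendsto.mono_left nhdsWithin_le_nhds)
    ((hM _).continuousAt.tendsto.mono_left nhdsWithin_le_nhds)
  simp only [hE_def, hM_def, cos_pi_div_two, sin_pi_div_two] at this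
  rw [le_div_iff₀ (by positivity)]
  refine le_of_mul_le_mul_right ?_ (by positivity : 0 < π / 16)
  linarith

/-- The test function cos θ / √a has mass ∫ cos² = π/4, free of the weight. Its energy ∫ r₂⁴ sin² /
a² has an explicit primitive and equals (π/4) r₂ / r₁. -/
theorem mu_le_sqrt_div_sqrt {r₁ r₂ : ℝ} (h₁ : 0 < r₁) (h₂ : 0 < r₂)
    (g : GroundState (weight (r₁ ^ 2) (r₂ ^ 2)) mu c P) : mu ≤ r₂ / r₁ := by
  have ha := weight_pos (pow_pos h₁ 2) (pow_pos h₂ 2)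
  set a := weight (r₁ ^ 2) (r₂ ^ 2) with ha_def
  have ha' : ∀ θ, HasDerivAt a (2 * (r₂ ^ 2 - r₁ ^ 2) * (sin θ * cos θ)) θ :=
    hasDerivAt_weight _ _
  have hsk : ∀ θ, HasDerivAt (fun t => sin t * cos t) (cos θ ^ 2 - sin θ ^ 2) θ := fun θ =>
    ((hasDerivAt_sin θ).mul (hasDerivAt_cos θ)).congr_deriv (by ring)
  have hφ : ∀ θ, HasDerivAt (fun t => cos t / √(a t)) (-(r₂ ^ 2 * sin θ / (a θ * √(a θ)))) θ := by
    intro θ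
    have hs : 0 < √(a θ) := sqrt_pos.2 (ha θ)
    have hsq : √(a θ) ^ 2 = a θ := sq_sqrt (ha θ).le
    refine ((hasDerivAt_cos θ).div ((ha' θ).sqrt (ha θ).ne') hs.ne').congr_deriv ?_
    rw [hsq]
    have := (ha θ).ne'
    field_simp
    rw [hsq]
    have e : a θ = r₁ ^ 2 * cos θ ^ 2 + r₂ ^ 2 * sin θ ^ 2 := rfl
    rw [e]
    linear_combination (-(r₂ ^ 2 * sin θ)) * sin_sq_add_cos_sq θ
  have hφsq : ∀ θ, a θ * (cos θ / √(a θ)) ^ 2 = cos θ ^ 2 := fun θ => by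
    have := (ha θ).ne'
    rw [div_pow, sq_sqrt (ha θ).le]
    field_simp
  have hφ'sq : ∀ θ, a θ * (-(r₂ ^ 2 * sin θ / (a θ * √(a θ)))) ^ 2 =
      r₂ ^ 4 * sin θ ^ 2 / a θ ^ 2 := fun θ => by
    have := (ha θ).ne'
    rw [neg_sq, div_pow, mul_pow (a θ), sq_sqrt (ha θ).le]
    field_simp
  set M : ℝ → ℝ := fun t => 1 / 2 * (t + sin t * cos t) with hM_def
  have hM : ∀ θ, HasDerivAt M (cos θ ^ 2) θ := fun θ => by
    refine (((hasDerivAt_id θ).add (hsk θ)).const_mul (1 / 2)).congr_deriv ?_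
    linear_combination (-1 / 2) * sin_sq_add_cos_sq θ
  set E : ℝ → ℝ := fun t => r₂ ^ 2 / 2 *
    (1 / (r₁ * r₂) * arctan (r₂ / r₁ * tan t) - sin t * cos t / a t) with hE_def
  have hE : ∀ θ ∈ Ico 0 (π / 2), HasDerivAt E (r₂ ^ 4 * sin θ ^ 2 / a θ ^ 2) θ := by
    intro θ hθ
    have hcos : cos θ ≠ 0 := (cos_pos_of_mem_Ioo ⟨by linarith [hθ.1, pi_pos], hθ.2⟩).ne'
    have haθ := (ha θ).ne'
    refine ((((hasDerivAt_arctan_mul_tan h₁ h₂ hcos).const_mul (1 / (r₁ * r₂))).sub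
      ((hsk θ).div (ha' θ) haθ)).const_mul (r₂ ^ 2 / 2)).congr_deriv ?_
    rw [← ha_def]
    field_simp
    have e : a θ = r₁ ^ 2 * cos θ ^ 2 + r₂ ^ 2 * sin θ ^ 2 := rfl
    rw [e]
    linear_combination (r₂ ^ 2 * sin θ ^ 2 - r₁ ^ 2 * cos θ ^ 2) * sin_sq_add_cos_sq θ
  have hlim : Tendsto E (𝓝[<] (π / 2)) (𝓝 (r₂ ^ 2 / 2 * (1 / (r₁ * r₂) * (π / 2) -
      sin (π / 2) * cos (π / 2) / a (π / 2)))) :=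
    (((tendsto_arctan_mul_tan (div_pos h₂ h₁)).const_mul _).sub
      (((hsk _).continuousAt.div (ha' _).continuousAt (ha _).ne').tendsto.mono_left
        nhdsWithin_le_nhds)).const_mul _
  have := g.mul_le_of_rayleigh ha hφ (by simp) (E := E) (M := M)
    (fun θ hθ => (hφ'sq θ).symm ▸ hE θ hθ) (fun θ _ => (hφsq θ).symm ▸ hM θ) (by simp [hE_def])
    (by simp [hM_def]) hlim ((hM _).continuousAt.tendsto.mono_left nhdsWithin_le_nhds)
  simp only [hM_def, cos_pi_div_two, mul_zero, zero_div, add_zero, sub_zero] at this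
  refine le_of_mul_le_mul_right (this.trans_eq' (by ring) |>.trans_eq ?_)
    (by positivity : 0 < π / 4)
  field_simp
  norm_num

/-- As a ≤ r₁² and c ≤ c(0), the flux is at least -K with K = mu r₁² c(0) π/2. Integrating c' = P /
a ≥ -K / a over the quarter circle gives c(0) ≤ K π / (2 r₁ r₂), and c(0) cancels. -/
theorem le_mu {r₁ r₂ : ℝ} (h : r₂ ≤ r₁) (h₂ : 0 < r₂)
    (g : GroundState (weight (r₁ ^ 2) (r₂ ^ 2)) mu c P) : 4 / π ^ 2 * (r₂ / r₁) ≤ mu := by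
  have h₁ := h₂.trans_le h
  have ha := weight_pos (pow_pos h₁ 2) (pow_pos h₂ 2)
  have hmu := g.mu_pos
  have hpi : (0 : ℝ) < π / 2 := by positivity
  set a := weight (r₁ ^ 2) (r₂ ^ 2) with ha_def
  have hale : ∀ θ, a θ ≤ r₁ ^ 2 := fun θ => by
    have h3 : r₂ ^ 2 ≤ r₁ ^ 2 := by gcongr
    rw [ha_def, weight]
    nlinarith [sin_sq_add_cos_sq θ, mul_nonneg (sub_nonneg.2 h3) (sq_nonneg (sin θ))]
  have hc0 : 0 < c 0 := g.pos 0 ⟨le_rfl, hpi⟩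
  have hanti : AntitoneOn c (Icc 0 (π / 2)) := by
    refine antitoneOn_of_deriv_nonpos (convex_Icc _ _) g.solves.continuous.continuousOn
      (fun t _ => (g.solves t).1.differentiableAt.differentiableWithinAt) fun t ht => ?_
    rw [interior_Icc] at ht
    rw [(g.solves t).1.deriv]
    exact div_nonpos_of_nonpos_of_nonneg (g.flux_neg ha t ⟨ht.1, ht.2.le⟩).le (ha t).le
  have hQ : MonotoneOn (fun t => P t + mu * (r₁ ^ 2 * c 0) * t) (Ico 0 (π / 2)) := by
    refine monotoneOn_Ico_of_hasDerivAt
      (fun t _ => (g.solves t).2.add ((hasDerivAt_id t).const_mul _)) fun t ht => ?_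
    have e1 : a t * c t ≤ r₁ ^ 2 * c 0 := mul_le_mul (hale t)
      (hanti (left_mem_Icc.2 hpi.le) ⟨ht.1, ht.2.le⟩ ht.1) (g.pos t ht).le (by positivity)
    nlinarith [mul_le_mul_of_nonneg_left e1 hmu.le]
  set K := mu * (r₁ ^ 2 * c 0) * (π / 2) with hK
  have hPK : ∀ t ∈ Ico 0 (π / 2), 0 ≤ P t + K := fun t ht => by
    have e1 := hQ ⟨le_rfl, hpi⟩ ht ht.1
    simp only [g.flux_zero, mul_zero, add_zero] at e1
    have e2 : mu * (r₁ ^ 2 * c 0) * t ≤ K := mul_le_mul_of_nonneg_left ht.2.le (by positivity)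
    linarith
  -- The arctangent term is K times the primitive of 1/a that vanishes at 0. It tends to K π / (2 r₁
  -- r₂) at π/2.
  have hmono : MonotoneOn (fun t => c t + K / (r₁ * r₂) * arctan (r₂ / r₁ * tan t))
      (Ico 0 (π / 2)) := by
    refine monotoneOn_Ico_of_hasDerivAt (fun t ht => (g.solves t).1.add
      ((hasDerivAt_arctan_mul_tan h₁ h₂
        (cos_pos_of_mem_Ioo ⟨by linarith [ht.1], ht.2⟩).ne').const_mul _)) fun t ht => ?_
    have e : P t / a t + K / (r₁ * r₂) * (r₁ * r₂ / weight (r₁ ^ 2) (r₂ ^ 2) t) =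
        (P t + K) / a t := by
      have := (ha t).ne'
      rw [← ha_def]
      field_simp
    rw [e]
    exact div_nonneg (hPK t ht) (ha t).le
  have hlim := ((g.solves (π / 2)).1.continuousAt.tendsto.mono_left nhdsWithin_le_nhds).add
    ((tendsto_arctan_mul_tan (div_pos h₂ h₁)).const_mul (K / (r₁ * r₂)))
  have hle := le_of_monotoneOn_Ico hmono hlim ⟨le_rfl, hpi⟩
  simp only [tan_zero, mul_zero, arctan_zero, add_zero, g.zero, zero_add] at hle
  have e : K / (r₁ * r₂) * (π / 2) = c 0 * (mu * (r₁ * π ^ 2 / (4 * r₂))) := by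
    rw [hK]
    field_simp
    norm_num
  rw [e] at hle
  have h4 : 1 ≤ mu * (r₁ * π ^ 2 / (4 * r₂)) := le_of_mul_le_mul_left (by linarith) hc0
  have h5 : 4 / π ^ 2 * (r₂ / r₁) = 1 / (r₁ * π ^ 2 / (4 * r₂)) := by field_simp
  rw [h5]
  exact (div_le_iff₀ (by positivity)).2 h4

end GroundState

end CircleSL

theorem theorem5p2 :
    -- the first nonzero eigenvalue exists, that is, the infimum defining it is attained
    (∀ a₁ a₂ : ℝ, a₂ ≤ a₁ → 0 < a₂ →
      IsLeast (CircleSL.nonzeroEigenvalues (CircleSL.weight a₁ a₂))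
        (CircleSL.lambda₁ (CircleSL.weight a₁ a₂))) ∧
    -- it is a strictly decreasing function of the ratio `a₁ / a₂` in `[1, ∞)`
    (∃ L : ℝ → ℝ, StrictAntiOn L (Set.Ici 1) ∧
      ∀ a₁ a₂ : ℝ, a₂ ≤ a₁ → 0 < a₂ →
        CircleSL.lambda₁ (CircleSL.weight a₁ a₂) = L (a₁ / a₂)) ∧
    -- two-sided bound with constants independent of `a₁` and `a₂`
    (∃ C₁ C₂ : ℝ, 0 < C₁ ∧ 0 < C₂ ∧
      ∀ a₁ a₂ : ℝ, a₂ ≤ a₁ → 0 < a₂ →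
        C₁ * √a₂ / √(a₁ + a₂) ≤ CircleSL.lambda₁ (CircleSL.weight a₁ a₂) ∧
        CircleSL.lambda₁ (CircleSL.weight a₁ a₂) ≤ C₂ * √a₂ / √(a₁ + a₂)) ∧
    -- explicit upper bound
    (∀ a₁ a₂ : ℝ, a₂ ≤ a₁ → 0 < a₂ →
      CircleSL.lambda₁ (CircleSL.weight a₁ a₂) ≤ (a₁ + 3 * a₂) / (3 * a₁ + a₂)) ∧
    -- simplicity, zeros and oddness for `a₁ > a₂`
    (∀ a₁ a₂ : ℝ, a₂ < a₁ → 0 < a₂ →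
      Module.finrank ℝ (CircleSL.eigenspace (CircleSL.weight a₁ a₂)
        (CircleSL.lambda₁ (CircleSL.weight a₁ a₂))) = 1 ∧
      ∀ u ∈ CircleSL.eigenspace (CircleSL.weight a₁ a₂)
          (CircleSL.lambda₁ (CircleSL.weight a₁ a₂)), u ≠ 0 →
        (∀ θ ∈ Set.Ico 0 (2 * Real.pi),
          u θ = 0 ↔ θ = Real.pi / 2 ∨ θ = 3 * Real.pi / 2) ∧
        (∀ t : ℝ, u (Real.pi / 2 + t) = -u (Real.pi / 2 - t)) ∧
        (∀ t : ℝ, u (3 * Real.pi / 2 + t) = -u (3 * Real.pi / 2 - t))) := by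
  refine ⟨fun a₁ a₂ h h₂ => ?_, ⟨_, CircleSL.strictAntiOn_lambda₁, fun a₁ a₂ h h₂ =>
    CircleSL.lambda₁_weight_eq h h₂⟩, ⟨4 / Real.pi ^ 2, √2, by positivity, by positivity,
    fun a₁ a₂ h h₂ => ?_⟩, fun a₁ a₂ h h₂ => ?_, fun a₁ a₂ h h₂ => ?_⟩
  · obtain ⟨mu, c, P, g⟩ := CircleSL.exists_groundState h h₂
    rw [g.lambda₁_eq h h₂]
    exact g.isLeast h h₂
  · obtain ⟨mu, c, P, g⟩ := CircleSL.exists_groundState h h₂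
    have h₁ := h₂.trans_le h
    rw [g.lambda₁_eq h h₂]
    have hr₂ : 0 < √a₂ := Real.sqrt_pos.2 h₂
    have hr₁ : 0 < √a₁ := Real.sqrt_pos.2 h₁
    -- With r₁ = √a₁ and r₂ = √a₂ the bounds are in terms of √a₂ / √a₁. Passing to √(a₁ + a₂) costs
    -- nothing below and a factor √2 above, since a₁ ≤ a₁ + a₂ ≤ 2a₁.
    rw [← Real.sq_sqrt h₁.le, ← Real.sq_sqrt h₂.le] at g
    constructor
    · refine le_trans ?_ (g.le_mu (Real.sqrt_le_sqrt h) hr₂)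
      rw [mul_div_assoc]
      gcongr
      linarith
    · refine (g.mu_le_sqrt_div_sqrt hr₁ hr₂).trans ?_
      have h3 : √(a₁ + a₂) ≤ √2 * √a₁ := by
        rw [← Real.sqrt_mul zero_le_two]
        exact Real.sqrt_le_sqrt (by linarith)
      rw [div_le_div_iff₀ hr₁ (Real.sqrt_pos.2 (by linarith))]
      nlinarith [mul_le_mul_of_nonneg_left h3 hr₂.le]
  · obtain ⟨mu, c, P, g⟩ := CircleSL.exists_groundState h h₂
    rw [g.lambda₁_eq h h₂]
    exact g.mu_le_div (h₂.trans_le h) h₂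
  · obtain ⟨mu, c, P, g⟩ := CircleSL.exists_groundState h.le h₂
    have h₁ := h₂.trans h
    rw [g.lambda₁_eq h.le h₂]
    constructor
    · rw [finrank_eq_one_iff_of_nonzero' (⟨c, g.mem_eigenspace h₁ h₂⟩ :
        CircleSL.eigenspace (CircleSL.weight a₁ a₂) mu) fun h0 => g.ne_zero (congrArg Subtype.val h0)]
      rintro ⟨u, hu⟩
      obtain ⟨k, rfl⟩ := (g.mem_eigenspace_iff_exists h h₂).1 hu
      exact ⟨k, rfl⟩
    · intro u hu hne
      obtain ⟨k, rfl⟩ := (g.mem_eigenspace_iff_exists h h₂).1 hu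
      have hk : k ≠ 0 := fun h0 => hne (by rw [h0, zero_smul])
      simp only [Pi.smul_apply, smul_eq_mul, ← mul_neg]
      refine ⟨fun θ hθ => ?_, fun t => ?_, fun t => ?_⟩
      · rw [mul_eq_zero, or_iff_right hk]
        exact g.eq_zero_iff h₁ h₂ hθ
      · rw [← g.odd h₁ h₂]
        congr 2
        ring
      -- Oddness about 3π/2 is oddness about π/2 followed by a shift by the period.
      · rw [← g.odd h₁ h₂, ← g.periodic h₁ h₂ (Real.pi - (3 * Real.pi / 2 - t))]
        congr 2
        ring
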